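/- Let $1<p<+\infty$, $\varepsilon_0>0$, $\lambda>0$ and $M\ge 0$. There exist constants $C>0$ and $\gamma>0$, depending only on $p$, $M$, $\varepsilon_0$ and $\lambda$, such that the following holds. Let $a\in L^\infty(\mathbb R_+\times(0,1))$ satisfy $\|a\|_{L^\infty(\mathbb R_+\times(0,1))}\le M$, $a\ge 0$ in $\mathbb R_+\times(0,1)$, and $a\ge\lambda$ in $\mathbb R_+\times(x_0-\varepsilon_0,x_0+\varepsilon_0)\subset\mathbb R_+\times(0,1)$ for some $x_0\in(0,1)$. Then for all $\rho_0,\xi_0\in L^p(0,1)$ the system $$\rho_t-\rho_x=-\tfrac12 a(\rho-\xi),\qquad \xi_t+\xi_x=\tfrac12 a(\rho-\xi)\qquad\text{in }\mathbb R_+\times(0,1),$$ $$\rho(t,0)-\xi(t,0)=\rho(t,1)-\xi(t,1)=0\ \text{ for } t\in\mathbb R_+,\qquad \rho(0,\cdot)=\rho_0,\quad \xi(0,\cdot)=\xi_0\ \text{ in }(0,1),$$ has a unique broad solution $(\rho,\xi)$, and, with $c_0=\tfrac12\int_0^1(\rho_0(x)+\xi_0(x))\,dx$, it satisfies $$\|(\rho-c_0,\xi-c_0)(t,\cdot)\|_{L^p(0,1)}\le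 C e^{-\gamma t}\,\|(\rho_0-c_0,\xi_0-c_0)\|_{L^p(0,1)}\qquad\text{for all } t\ge 0,$$ where $\|(f,g)\|_{L^p(0,1)}^p=\int_0^1(|f|^p+|g|^p)\,dx$. Here a broad solution is a pair $(\rho,\xi)$ such that, for every $T>0$, both $\rho$ and $\xi$ belong to $C([0,T];L^p(0,1))\cap C([0,1];L^p(0,T))$, the initial conditions hold a.e. in $(0,1)$ and the boundary conditions hold a.e. in $(0,T)$, and for a.e. $(t,x)\in(0,T)\times(0,1)$, with $\sigma=\max\{0,t+x-1\}$ and $\theta=\max\{0,t-x\}$, $$\rho(t,x)=\rho(\sigma,x+t-\sigma)-\tfrac12\int_\sigma^t \big(a(\rho-\xi)\big)(s,x+t-s)\,ds,$$ $$\xi(t,x)=\xi(\theta,x-t+\theta)+\tfrac12\int_\theta^t \big(a(\rho-\xi)\big)(s,x-t+s)\,ds.$$ -/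

import Mathlib

open MeasureTheory Set Filter
open scoped Topology ENNReal NNReal

namespace DampedWave

/-- `f ∈ C(I; L^p(μ))`, for a family `f y : ℝ → ℝ` of functions indexed by `y ∈ I`. -/
def ContinuousIntoLp (p : ℝ≥0∞) (μ : Measure ℝ) (I : Set ℝ) (f : ℝ → ℝ → ℝ) : Prop :=
  (∀ y ∈ I, MemLp (f y) p μ) ∧
    ∀ y₀ ∈ I, Tendsto (fun y => eLpNorm (fun z => f y z - f y₀ z) p μ) (𝓝[I] y₀) (𝓝 0)

/-- `u ∈ C([0, T]; L^p(0, 1)) ∩ C([0, 1]; L^p(0, T))`, for a function `u t x` of the time `t` and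
the position `x`. The function `u` is a representative for which every slice `u t ·` is the value
at `t` of the first continuous map and every slice `u · x` is the value at `x` of the second
one, so that `u · 0` and `u · 1` are the boundary traces and `u 0 ·` is the initial trace. -/
structure InBroadSpace (p : ℝ≥0∞) (T : ℝ) (u : ℝ → ℝ → ℝ) : Prop where
  aestronglyMeasurable : AEStronglyMeasurable (fun z : ℝ × ℝ => u z.1 z.2)
    (volume.restrict (Ioo (0 : ℝ) T ×ˢ Ioo (0 : ℝ) 1))
  continuous_time : ContinuousIntoLp p (volume.restrict (Ioo (0 : ℝ) 1)) (Icc 0 T)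
    (fun t x => u t x)
  continuous_space : ContinuousIntoLp p (volume.restrict (Ioo (0 : ℝ) T)) (Icc 0 1)
    (fun x t => u t x)

/-- `(ρ, ξ)` is a broad solution on `(0, T) × (0, 1)` of
`ρ_t - ρ_x = -(1/2) a (ρ - ξ)`, `ξ_t + ξ_x = (1/2) a (ρ - ξ)`,
`ρ - ξ = 0` at `x = 0` and at `x = 1`, `ρ(0, ·) = ρ₀`, `ξ(0, ·) = ξ₀`.

The characteristic of `ρ` through `(t, x)` is `s ↦ (s, x + t - s)`; followed backwards from
`(t, x)` it leaves the domain at time `max 0 (t + x - 1)`, either through `{0} × [0, 1]` or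
through `x = 1`. The characteristic of `ξ` through `(t, x)` is `s ↦ (s, x - t + s)`; followed
backwards it leaves the domain at time `max 0 (t - x)`. -/
structure IsBroadSolutionOn (p : ℝ≥0∞) (a : ℝ → ℝ → ℝ) (ρ₀ ξ₀ : ℝ → ℝ) (T : ℝ)
    (ρ ξ : ℝ → ℝ → ℝ) : Prop where
  mem_left : InBroadSpace p T ρ
  mem_right : InBroadSpace p T ξ
  char_left : ∀ᵐ z : ℝ × ℝ ∂(volume.restrict (Ioo (0 : ℝ) T ×ˢ Ioo (0 : ℝ) 1)),
    ρ z.1 z.2 =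
      ρ (max 0 (z.1 + z.2 - 1)) (z.2 + z.1 - max 0 (z.1 + z.2 - 1)) +
        ∫ s in (max 0 (z.1 + z.2 - 1))..z.1,
          -(1 / 2 : ℝ) * a s (z.2 + z.1 - s) * (ρ s (z.2 + z.1 - s) - ξ s (z.2 + z.1 - s))
  char_right : ∀ᵐ z : ℝ × ℝ ∂(volume.restrict (Ioo (0 : ℝ) T ×ˢ Ioo (0 : ℝ) 1)),
    ξ z.1 z.2 =
      ξ (max 0 (z.1 - z.2)) (z.2 - z.1 + max 0 (z.1 - z.2)) +
        ∫ s in (max 0 (z.1 - z.2))..z.1,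
          (1 / 2 : ℝ) * a s (z.2 - z.1 + s) * (ρ s (z.2 - z.1 + s) - ξ s (z.2 - z.1 + s))
  boundary_zero : ∀ᵐ t ∂(volume.restrict (Ioo (0 : ℝ) T)), ρ t 0 - ξ t 0 = 0
  boundary_one : ∀ᵐ t ∂(volume.restrict (Ioo (0 : ℝ) T)), ρ t 1 - ξ t 1 = 0
  initial_left : ∀ᵐ x ∂(volume.restrict (Ioo (0 : ℝ) 1)), ρ 0 x = ρ₀ x
  initial_right : ∀ᵐ x ∂(volume.restrict (Ioo (0 : ℝ) 1)), ξ 0 x = ξ₀ x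

/-- A broad solution on `ℝ₊ × (0, 1)`: a broad solution up to every finite time. -/
def IsBroadSolution (p : ℝ≥0∞) (a : ℝ → ℝ → ℝ) (ρ₀ ξ₀ : ℝ → ℝ) (ρ ξ : ℝ → ℝ → ℝ) : Prop :=
  ∀ T : ℝ, 0 < T → IsBroadSolutionOn p a ρ₀ ξ₀ T ρ ξ

/-- The norm `‖(f, g)‖_{L^p(0,1)} = (∫₀¹ |f|^p + |g|^p)^{1/p}` for `0 < p < ∞`. -/
noncomputable def pairLpNorm (p : ℝ≥0∞) (f g : ℝ → ℝ) : ℝ≥0∞ :=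
  ((∫⁻ x in Ioo (0 : ℝ) 1, (‖f x‖ₑ ^ p.toReal + ‖g x‖ₑ ^ p.toReal)) ^ (1 / p.toReal))

/-- The constant `c₀ = (1/2) ∫₀¹ (ρ₀ + ξ₀) dx`. -/
noncomputable def meanValue (ρ₀ ξ₀ : ℝ → ℝ) : ℝ :=
  (1 / 2 : ℝ) * ∫ x in (0 : ℝ)..1, (ρ₀ x + ξ₀ x)

end DampedWave

/-!
The system is solved on the circle of length `2` obtained by gluing two copies of `(0, 1)` at their
ends: `ξ` lives on the first copy, `ρ` on the second one, traversed backwards. There the boundary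
conditions disappear, and the system is a single transport equation with unit speed, with a damping
that pulls together the values at `y` and `-y`. In the coordinate `z = y - t`, which is constant
along the characteristics, it becomes `∂ₜ v = r (v ∘ R - v)`, where `R` is the time-dependent
reflection `z ↦ -z - 2t` and `r = a / 2`. This is the backward equation of a jump process
(`JumpProcess`) whose jumps preserve the volume.

*Decay.* In a damped interval of half-length `ε₀`, the jump time is spread over an interval, and a
jump at time `s` leads to `-z - 2s`, so one jump spreads the position over an interval of length
`4ε₀`; each further jump lets the interval grow, until it covers the circle. Hence the transition
probabilities over a time step `τ` that depends only on `ε₀` all dominate `κ` times the volume, with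
`κ > 0` depending only on `M`, `l` and `ε₀` (`exists_smul_volume_le_kernel`). By Doeblin's argument,
combined with Jensen's inequality, a time step contracts the `L^p` norm on functions of mean zero
by the factor `1 - 2κ` (`JumpProcess.lintegral_gap_evol_le_mul`); the mean value subtracted from the
data is `c₀`.

*Existence.* The solution is given by the Dyson series of the jump equation, whose terms are
positive measures, so that it converges for all nonnegative data; real data are split into positive
and negative parts. Since `z` is constant along the characteristics, the integral equations of broad
solutions are those of the jump equation at fixed `z`, and both continuity requirements follow from
dominated convergence and the continuity of translations in `L^p` (`Damping.inBroadSpace_wave`,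
`Damping.isBroadSolutionOn_wave`).

*Uniqueness.* For the difference of two broad solutions, the roles of `t` and `x` are exchanged:
with the weight `exp (-k t)` in time, the passage from one end of the interval to the other gains
the factor `exp (-k)`, and the right-hand side contributes a factor `M / k`, so that for large `k`
the difference vanishes (`transport_estimate`, `IsBroadSolutionOn.eq_zero`). Hence the decay of the
solution that was constructed is that of every broad solution.
-/

namespace DampedWave

/-! ### Jump processes and their Dyson series -/

/-- A jump mechanism on `(Z, μ)`: at time `s` a particle at `z` jumps to `refl s z` at rate
`jump s z ≤ bound`. The complementary rate `stay = bound - jump` is recorded as a field, so that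
the generator is `-bound` plus an operator with nonnegative coefficients. The last two fields say
that `μ` is invariant under the flow. -/
structure JumpProcess (Z : Type*) [MeasurableSpace Z] (μ : Measure Z) where
  bound : ℝ≥0
  jump : ℝ → Z → ℝ≥0∞
  stay : ℝ → Z → ℝ≥0∞
  refl : ℝ → Z → Z
  measurable_jump : Measurable (Function.uncurry jump)
  measurable_stay : Measurable (Function.uncurry stay)
  measurable_refl : Measurable (Function.uncurry refl)
  stay_add_jump : ∀ s z, stay s z + jump s z = bound
  measurePreserving_refl : ∀ s, MeasurePreserving (refl s) μ μ
  jump_refl : ∀ s z, jump s (refl s z) = jump s z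

namespace JumpProcess

variable {Z : Type*} [MeasurableSpace Z] {μ : Measure Z} (X : JumpProcess Z μ)

/-- The `n`-th term of the Dyson series of the equation `∂ₜ v = stay * v + jump * v ∘ refl` started
at time `t₀`, as a measure: the solution with initial value `f` is
`v t z = ∑ n, ∫ f ∂(series t₀ n t z)`. -/
noncomputable def series (t₀ : ℝ) : ℕ → ℝ → Z → Measure Z
  | 0, _, z => Measure.dirac z
  | n + 1, t, z => (volume.restrict (Ioc t₀ t)).bind fun s =>
      X.stay s z • series t₀ n s z + X.jump s z • series t₀ n s (X.refl s z)

theorem measurable_uncurry_refl : Measurable fun x : ℝ × Z => (x.1, X.refl x.1 x.2) :=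
  measurable_fst.prodMk X.measurable_refl

theorem measurable_generator {κ : ℝ → Z → Measure Z}
    (hκ : Measurable (Function.uncurry κ)) :
    Measurable fun x : ℝ × Z =>
      X.stay x.1 x.2 • κ x.1 x.2 + X.jump x.1 x.2 • κ x.1 (X.refl x.1 x.2) := by
  have h2 := hκ.comp X.measurable_uncurry_refl
  refine Measure.measurable_of_measurable_coe _ fun s hs => ?_
  have e1 := (Measure.measurable_coe hs).comp hκ
  have e2 := (Measure.measurable_coe hs).comp h2
  simp only [Measure.add_apply, Measure.smul_apply, smul_eq_mul]
  exact (X.measurable_stay.mul e1).add (X.measurable_jump.mul e2)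

theorem measurable_lintegral_Ioc {g : ℝ × Z → ℝ≥0∞} (hg : Measurable g) (t₀ : ℝ) :
    Measurable fun x : ℝ × Z => ∫⁻ s in Ioc t₀ x.1, g (s, x.2) := by
  have : (fun x : ℝ × Z => ∫⁻ s in Ioc t₀ x.1, g (s, x.2)) =
      fun x => ∫⁻ s, {y : (ℝ × Z) × ℝ | t₀ < y.2 ∧ y.2 ≤ y.1.1}.indicator
        (fun y => g (y.2, y.1.2)) (x, s) := by
    ext x
    rw [← lintegral_indicator measurableSet_Ioc]
    rfl
  rw [this]
  refine Measurable.lintegral_prod_right' (f := fun y : (ℝ × Z) × ℝ => _) ?_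
  refine Measurable.indicator (by fun_prop) ?_
  exact (measurableSet_lt measurable_const measurable_snd).inter
    (measurableSet_le measurable_snd measurable_fst.fst)

theorem measurable_series (t₀ : ℝ) (n : ℕ) :
    Measurable (Function.uncurry (X.series t₀ n)) := by
  induction n with
  | zero => exact Measure.measurable_dirac.comp measurable_snd
  | succ n ih =>
    have hg := X.measurable_generator ih
    refine Measure.measurable_of_measurable_coe _ fun s hs => ?_
    have : (fun x : ℝ × Z => Function.uncurry (X.series t₀ (n + 1)) x s) = fun x =>
        ∫⁻ u in Ioc t₀ x.1, (fun x : ℝ × Z => (X.stay x.1 x.2 • X.series t₀ n x.1 x.2 +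
          X.jump x.1 x.2 • X.series t₀ n x.1 (X.refl x.1 x.2)) s) (u, x.2) := by
      ext x
      simp only [Function.uncurry, series]
      rw [Measure.bind_apply hs]
      exact (hg.comp (measurable_id.prodMk measurable_const)).aemeasurable
    rw [this]
    exact measurable_lintegral_Ioc ((Measure.measurable_coe hs).comp hg) t₀

/-- The `n`-th term of the Dyson series applied to `f`. -/
noncomputable def term (t₀ : ℝ) (n : ℕ) (f : Z → ℝ≥0∞) (t : ℝ) (z : Z) : ℝ≥0∞ :=
  ∫⁻ y, f y ∂X.series t₀ n t z

variable {f g : Z → ℝ≥0∞}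

theorem measurable_term (hf : Measurable f) (t₀ : ℝ) (n : ℕ) :
    Measurable fun x : ℝ × Z => X.term t₀ n f x.1 x.2 :=
  (Measure.measurable_lintegral hf).comp (X.measurable_series t₀ n)

theorem term_zero (hf : Measurable f) (t₀ t : ℝ) (z : Z) : X.term t₀ 0 f t z = f z :=
  lintegral_dirac' z hf

theorem term_succ (hf : Measurable f) (t₀ : ℝ) (n : ℕ) (t : ℝ) (z : Z) :
    X.term t₀ (n + 1) f t z = ∫⁻ s in Ioc t₀ t,
      (X.stay s z * X.term t₀ n f s z + X.jump s z * X.term t₀ n f s (X.refl s z)) := by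
  have hg : Measurable fun s => X.stay s z • X.series t₀ n s z +
      X.jump s z • X.series t₀ n s (X.refl s z) :=
    (X.measurable_generator (X.measurable_series t₀ n)).comp measurable_prodMk_right
  simp only [term, series]
  rw [Measure.lintegral_bind hg.aemeasurable hf.aemeasurable]
  simp [lintegral_add_measure, lintegral_smul_measure]

theorem measurable_apply_generator {w : ℝ → Z → ℝ≥0∞}
    (hw : Measurable fun x : ℝ × Z => w x.1 x.2) :
    Measurable fun x : ℝ × Z =>
      X.stay x.1 x.2 * w x.1 x.2 + X.jump x.1 x.2 * w x.1 (X.refl x.1 x.2) :=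
  (X.measurable_stay.mul hw).add (X.measurable_jump.mul (hw.comp X.measurable_uncurry_refl))

theorem lintegral_pow_div_factorial (m : ℝ≥0) {t₀ t : ℝ} (h : t₀ ≤ t) (n : ℕ) :
    ∫⁻ s in Ioc t₀ t, (m : ℝ≥0∞) * ENNReal.ofReal ((m * (s - t₀)) ^ n / n.factorial) =
      ENNReal.ofReal ((m * (t - t₀)) ^ (n + 1) / (n + 1).factorial) := by
  have e : ∀ s ∈ Ioc t₀ t, (m : ℝ≥0∞) * ENNReal.ofReal ((m * (s - t₀)) ^ n / n.factorial) =
      ENNReal.ofReal (m * ((m * (s - t₀)) ^ n / n.factorial)) := fun s hs => by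
    rw [ENNReal.ofReal_mul m.coe_nonneg, ENNReal.ofReal_coe_nnreal]
  rw [setLIntegral_congr_fun measurableSet_Ioc e, ← ofReal_integral_eq_lintegral_ofReal,
    ← intervalIntegral.integral_of_le h]
  · congr 1
    have hd : ∀ s : ℝ, HasDerivAt (fun s => (m * (s - t₀)) ^ (n + 1) / (n + 1).factorial)
        (m * ((m * (s - t₀)) ^ n / n.factorial) : ℝ) s := fun s => by
      have h1 : HasDerivAt (fun s => (m : ℝ) * (s - t₀)) m s := by
        simpa using ((hasDerivAt_id s).sub_const t₀).const_mul (m : ℝ)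
      refine ((h1.pow (n + 1)).div_const ((n + 1).factorial : ℝ)).congr_deriv ?_
      rw [Nat.factorial_succ]
      push_cast
      have : (n.factorial : ℝ) ≠ 0 := by positivity
      have : (n + 1 : ℝ) ≠ 0 := by positivity
      field_simp
    rw [intervalIntegral.integral_eq_sub_of_hasDerivAt (fun s _ => hd s)]
    · simp
    · exact Continuous.intervalIntegrable (by fun_prop) _ _
  · exact (Continuous.integrableOn_Icc (by fun_prop)).mono_set Ioc_subset_Icc_self
  · refine (ae_restrict_iff' measurableSet_Ioc).2 (ae_of_all _ fun s hs => ?_)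
    have : 0 ≤ s - t₀ := by linarith [hs.1]
    positivity

theorem term_one {t₀ t : ℝ} (h : t₀ ≤ t) (n : ℕ) (z : Z) :
    X.term t₀ n (fun _ => 1) t z =
      ENNReal.ofReal ((X.bound * (t - t₀)) ^ n / n.factorial) := by
  induction n generalizing t z with
  | zero => rw [X.term_zero measurable_const]; simp
  | succ n ih =>
    rw [X.term_succ measurable_const, ← lintegral_pow_div_factorial _ h]
    refine setLIntegral_congr_fun measurableSet_Ioc fun s hs => ?_
    rw [ih hs.1.le, ih hs.1.le, ← add_mul, X.stay_add_jump]

/-- The measure `μ` is invariant under the exchange between `z` and `refl s z`. -/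
theorem lintegral_apply_generator {w : Z → ℝ≥0∞} (hw : Measurable w) (s : ℝ) :
    ∫⁻ z, (X.stay s z * w z + X.jump s z * w (X.refl s z)) ∂μ = X.bound * ∫⁻ z, w z ∂μ := by
  have hj : Measurable (X.jump s) := X.measurable_jump.comp measurable_prodMk_left
  have hs : Measurable (X.stay s) := X.measurable_stay.comp measurable_prodMk_left
  have e : ∫⁻ z, X.jump s z * w (X.refl s z) ∂μ = ∫⁻ z, X.jump s z * w z ∂μ := by
    rw [← (X.measurePreserving_refl s).lintegral_comp (f := fun z => X.jump s z * w z)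
      (by fun_prop)]
    simp [X.jump_refl]
  have hsw : Measurable fun z => X.stay s z * w z := hs.mul hw
  rw [lintegral_add_left hsw, e, ← lintegral_add_left hsw, ← lintegral_const_mul _ hw]
  simp_rw [← add_mul, X.stay_add_jump]

theorem lintegral_term [SFinite μ] (hf : Measurable f) {t₀ t : ℝ} (h : t₀ ≤ t) (n : ℕ) :
    ∫⁻ z, X.term t₀ n f t z ∂μ =
      ENNReal.ofReal ((X.bound * (t - t₀)) ^ n / n.factorial) * ∫⁻ z, f z ∂μ := by
  induction n generalizing t with
  | zero => simp [X.term_zero hf]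
  | succ n ih =>
    simp_rw [X.term_succ hf]
    have hm := X.measurable_term hf t₀ n
    have hg := X.measurable_apply_generator hm
    rw [lintegral_lintegral_swap, ← lintegral_pow_div_factorial _ h, ← lintegral_mul_const]
    · refine setLIntegral_congr_fun measurableSet_Ioc fun s hs => ?_
      have hw : Measurable (X.term t₀ n f s) := hm.comp measurable_prodMk_left
      rw [X.lintegral_apply_generator hw, ih hs.1.le, mul_assoc]
    · fun_prop
    · exact (hg.comp measurable_swap).aemeasurable

/-- The rescaled flow: the sum of the Dyson series applied to `f`, that is, the solution of
`∂ₜ v = stay * v + jump * v ∘ refl` with `v t₀ = f`. It equals `exp (bound * (t - t₀))` times the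
expectation of `f` along the jump process run backwards from time `t` to time `t₀`. -/
noncomputable def flow (t₀ : ℝ) (f : Z → ℝ≥0∞) (t : ℝ) (z : Z) : ℝ≥0∞ :=
  ∑' n, X.term t₀ n f t z

theorem measurable_flow (hf : Measurable f) (t₀ : ℝ) :
    Measurable fun x : ℝ × Z => X.flow t₀ f x.1 x.2 :=
  Measurable.tsum fun n => X.measurable_term hf t₀ n

theorem measurable_flow_right (hf : Measurable f) (t₀ t : ℝ) : Measurable (X.flow t₀ f t) :=
  (X.measurable_flow hf t₀).comp measurable_prodMk_left

/-- The integral equation of the flow. -/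
theorem flow_eq (hf : Measurable f) (t₀ t : ℝ) (z : Z) :
    X.flow t₀ f t z = f z + ∫⁻ s in Ioc t₀ t,
      (X.stay s z * X.flow t₀ f s z + X.jump s z * X.flow t₀ f s (X.refl s z)) := by
  have hm : ∀ n, Measurable fun s => X.stay s z * X.term t₀ n f s z +
      X.jump s z * X.term t₀ n f s (X.refl s z) := fun n =>
    (X.measurable_apply_generator (X.measurable_term hf t₀ n)).comp measurable_prodMk_right
  rw [flow, tsum_eq_zero_add' ENNReal.summable, X.term_zero hf]
  simp_rw [X.term_succ hf]
  rw [← lintegral_tsum fun n => (hm n).aemeasurable]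
  simp_rw [flow, ENNReal.tsum_add, ENNReal.tsum_mul_left]

theorem tsum_ofReal_pow_div_factorial {x : ℝ} (hx : 0 ≤ x) :
    ∑' n : ℕ, ENNReal.ofReal (x ^ n / n.factorial) = ENNReal.ofReal (Real.exp x) := by
  rw [← ENNReal.ofReal_tsum_of_nonneg (fun n => by positivity)
    (Real.summable_pow_div_factorial x), Real.exp_eq_exp_ℝ, NormedSpace.exp_eq_tsum_div]

theorem lintegral_flow [SFinite μ] (hf : Measurable f) {t₀ t : ℝ} (h : t₀ ≤ t) :
    ∫⁻ z, X.flow t₀ f t z ∂μ =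
      ENNReal.ofReal (Real.exp (X.bound * (t - t₀))) * ∫⁻ z, f z ∂μ := by
  have hm : ∀ n, Measurable (X.term t₀ n f t) := fun n =>
    (X.measurable_term hf t₀ n).comp measurable_prodMk_left
  simp_rw [flow]
  rw [lintegral_tsum fun n => (hm n).aemeasurable]
  simp_rw [X.lintegral_term hf h]
  rw [ENNReal.tsum_mul_right, tsum_ofReal_pow_div_factorial]
  exact mul_nonneg X.bound.2 (sub_nonneg.2 h)

theorem flow_mono (hf : Measurable f) (t₀ : ℝ) {s t : ℝ} (h : s ≤ t) (z : Z) :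
    X.flow t₀ f s z ≤ X.flow t₀ f t z := by
  rw [X.flow_eq hf, X.flow_eq hf t₀ t]
  gcongr

theorem le_flow (hf : Measurable f) (t₀ t : ℝ) (z : Z) : f z ≤ X.flow t₀ f t z := by
  rw [X.flow_eq hf]
  exact le_self_add

theorem flow_self (hf : Measurable f) {t₀ t : ℝ} (h : t ≤ t₀) (z : Z) : X.flow t₀ f t z = f z := by
  rw [X.flow_eq hf]
  simp [Ioc_eq_empty (not_lt.2 h)]

/-- Composition law for the terms of the Dyson series: the jumps up to time `t` are those before
and those after an intermediate time `t₁`. -/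
theorem term_comp (hf : Measurable f) {t₀ t₁ t : ℝ} (h₀ : t₀ ≤ t₁) (h₁ : t₁ ≤ t) (n : ℕ) (z : Z) :
    X.term t₀ n f t z = ∑ jk ∈ Finset.HasAntidiagonal.antidiagonal n,
      X.term t₁ jk.1 (X.term t₀ jk.2 f t₁) t z := by
  have hm : ∀ k, Measurable (X.term t₀ k f t₁) := fun k =>
    (X.measurable_term hf t₀ k).comp measurable_prodMk_left
  induction n generalizing t z with
  | zero => simp [X.term_zero hf, X.term_zero (hm 0)]
  | succ n ih =>
    have hg : ∀ j k, Measurable fun s => X.stay s z * X.term t₁ j (X.term t₀ k f t₁) s z +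
        X.jump s z * X.term t₁ j (X.term t₀ k f t₁) s (X.refl s z) := fun j k =>
      (X.measurable_apply_generator (X.measurable_term (hm k) t₁ j)).comp measurable_prodMk_right
    rw [X.term_succ hf, ← Ioc_union_Ioc_eq_Ioc h₀ h₁, lintegral_union measurableSet_Ioc
      (Ioc_disjoint_Ioc_of_le le_rfl), ← X.term_succ hf t₀ n t₁ z,
      Finset.Nat.antidiagonal_succ, Finset.sum_cons, X.term_zero (hm _)]
    congr 1
    rw [Finset.sum_map]
    simp only [Function.Embedding.coe_prodMap, Function.Embedding.coeFn_mk, Prod.map_fst,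
      Prod.map_snd, Function.Embedding.refl_apply, Nat.succ_eq_add_one]
    simp_rw [X.term_succ (hm _)]
    rw [← lintegral_finsetSum _ fun jk _ => hg _ _]
    refine setLIntegral_congr_fun measurableSet_Ioc fun s hs => ?_
    rw [ih hs.1.le, ih hs.1.le, Finset.mul_sum, Finset.mul_sum, Finset.sum_add_distrib]

theorem tsum_sum_antidiagonal (F : ℕ → ℕ → ℝ≥0∞) :
    ∑' n, ∑ jk ∈ Finset.HasAntidiagonal.antidiagonal n, F jk.1 jk.2 = ∑' j, ∑' k, F j k := by
  rw [← ENNReal.tsum_prod, ← Finset.HasAntidiagonal.sigmaAntidiagonalEquivProd.tsum_eq,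
    ENNReal.tsum_sigma']
  refine tsum_congr fun n => ?_
  rw [← Finset.tsum_subtype]
  rfl

theorem term_tsum {F : ℕ → Z → ℝ≥0∞} (hF : ∀ k, Measurable (F k)) (t₀ : ℝ) (n : ℕ) (t : ℝ)
    (z : Z) : X.term t₀ n (fun y => ∑' k, F k y) t z = ∑' k, X.term t₀ n (F k) t z :=
  lintegral_tsum fun k => (hF k).aemeasurable

/-- The flow has the evolution property. -/
theorem flow_comp (hf : Measurable f) {t₀ t₁ t : ℝ} (h₀ : t₀ ≤ t₁) (h₁ : t₁ ≤ t) (z : Z) :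
    X.flow t₀ f t z = X.flow t₁ (X.flow t₀ f t₁) t z := by
  have hm : ∀ k, Measurable (X.term t₀ k f t₁) := fun k =>
    (X.measurable_term hf t₀ k).comp measurable_prodMk_left
  simp only [flow]
  simp_rw [X.term_comp hf h₀ h₁]
  rw [tsum_sum_antidiagonal fun j k => X.term t₁ j (X.term t₀ k f t₁) t z]
  refine tsum_congr fun j => ?_
  exact (X.term_tsum hm t₁ j t z).symm

/-- The transition probability of the jump process run backwards from time `t` to time `t₀`. -/
noncomputable def kernel (t₀ t : ℝ) (z : Z) : Measure Z :=
  ENNReal.ofReal (Real.exp (-(X.bound * (t - t₀)))) • Measure.sum fun n => X.series t₀ n t z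

theorem lintegral_kernel (t₀ t : ℝ) (z : Z) (f : Z → ℝ≥0∞) :
    ∫⁻ y, f y ∂X.kernel t₀ t z =
      ENNReal.ofReal (Real.exp (-(X.bound * (t - t₀)))) * X.flow t₀ f t z := by
  rw [kernel, lintegral_smul_measure, lintegral_sum_measure]
  rfl

theorem ofReal_exp_neg_mul (x : ℝ) :
    ENNReal.ofReal (Real.exp (-x)) * ENNReal.ofReal (Real.exp x) = 1 := by
  rw [← ENNReal.ofReal_mul (Real.exp_nonneg _), ← Real.exp_add]
  simp

theorem isProbabilityMeasure_kernel {t₀ t : ℝ} (h : t₀ ≤ t) (z : Z) :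
    IsProbabilityMeasure (X.kernel t₀ t z) := by
  constructor
  rw [← lintegral_one, X.lintegral_kernel, flow]
  simp_rw [X.term_one h]
  rw [tsum_ofReal_pow_div_factorial, ofReal_exp_neg_mul]
  exact mul_nonneg X.bound.2 (sub_nonneg.2 h)

theorem lintegral_lintegral_kernel [SFinite μ] (hf : Measurable f) {t₀ t : ℝ} (h : t₀ ≤ t) :
    ∫⁻ z, ∫⁻ y, f y ∂X.kernel t₀ t z ∂μ = ∫⁻ z, f z ∂μ := by
  simp_rw [X.lintegral_kernel]
  rw [lintegral_const_mul _ (X.measurable_flow_right hf t₀ t), X.lintegral_flow hf h, ← mul_assoc,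
    ofReal_exp_neg_mul, one_mul]

end JumpProcess

/-! ### Doeblin's argument in `L^p` -/

/-- The distance `|x - y|` between two extended nonnegative reals; it is `0` for `x = y = ∞`. -/
noncomputable def gap (x y : ℝ≥0∞) : ℝ≥0∞ := (x - y) + (y - x)

theorem measurable_gap {Z : Type*} [MeasurableSpace Z] {f g : Z → ℝ≥0∞} (hf : Measurable f)
    (hg : Measurable g) : Measurable fun z => gap (f z) (g z) :=
  (hf.sub hg).add (hg.sub hf)

theorem enorm_toReal_sub_toReal_le_gap (x y : ℝ≥0∞) : ‖x.toReal - y.toReal‖ₑ ≤ gap x y := by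
  by_cases hx : x = ∞
  · by_cases hy : y = ∞
    · simp [hx, hy, gap]
    · simp [hx, hy, gap]
  · by_cases hy : y = ∞
    · simp [hx, hy, gap]
    · lift x to ℝ≥0 using hx
      lift y to ℝ≥0 using hy
      simp only [gap, ENNReal.coe_toReal, ← ENNReal.coe_sub, ← ENNReal.coe_add]
      rw [enorm_le_coe, ← NNReal.coe_le_coe, coe_nnnorm, NNReal.coe_add, Real.norm_eq_abs, abs_le]
      have h1 := NNReal.sub_def (r := x) (p := y)
      have h2 := NNReal.sub_def (r := y) (p := x)
      rw [h1, h2, Real.coe_toNNReal', Real.coe_toNNReal']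
      constructor
      · linarith [le_max_left ((y : ℝ) - x) 0, le_max_right ((x : ℝ) - y) 0]
      · linarith [le_max_left ((x : ℝ) - y) 0, le_max_right ((y : ℝ) - x) 0]

theorem gap_ofReal_ofReal_neg (x : ℝ) : gap (ENNReal.ofReal x) (ENNReal.ofReal (-x)) = ‖x‖ₑ := by
  rcases le_total 0 x with h | h
  · simp [gap, ENNReal.ofReal_of_nonpos (neg_nonpos.2 h), Real.enorm_eq_ofReal h]
  · rw [← enorm_neg, Real.enorm_eq_ofReal (neg_nonneg.2 h)]
    simp [gap, ENNReal.ofReal_of_nonpos h]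

/-- Jensen's inequality for the power function. -/
theorem lintegral_rpow_le {Z : Type*} [MeasurableSpace Z] (κ : Measure Z) {p : ℝ} (hp : 1 < p)
    {f : Z → ℝ≥0∞} (hf : AEMeasurable f κ) :
    (∫⁻ z, f z ∂κ) ^ p ≤ κ univ ^ (p - 1) * ∫⁻ z, f z ^ p ∂κ := by
  have h0 : 0 < p := by linarith
  have hpq := Real.HolderConjugate.conjExponent hp
  have h := ENNReal.lintegral_mul_le_Lp_mul_Lq κ hpq hf aemeasurable_const (g := fun _ => 1)
  have h2 := ENNReal.rpow_le_rpow h h0.le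
  simp only [Pi.mul_apply, mul_one, ENNReal.one_rpow, lintegral_const, one_mul] at h2
  refine h2.trans_eq ?_
  rw [ENNReal.mul_rpow_of_nonneg _ _ h0.le, ← ENNReal.rpow_mul, ← ENNReal.rpow_mul,
    one_div_mul_cancel h0.ne', ENNReal.rpow_one, mul_comm]
  congr 2
  have := hpq.symm.sub_one_mul_conj
  have h3 : p - 1 ≠ 0 := by linarith
  rw [Real.conjExponent]
  field_simp

namespace JumpProcess

variable {Z : Type*} [MeasurableSpace Z] {μ : Measure Z} (X : JumpProcess Z μ)

/-- The evolution of the initial value `f`, from time `t₀` to time `t`. -/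
noncomputable def evol (t₀ : ℝ) (f : Z → ℝ≥0∞) (t : ℝ) (z : Z) : ℝ≥0∞ :=
  ∫⁻ y, f y ∂X.kernel t₀ t z

theorem evol_eq (t₀ : ℝ) (f : Z → ℝ≥0∞) (t : ℝ) (z : Z) : X.evol t₀ f t z =
    ENNReal.ofReal (Real.exp (-(X.bound * (t - t₀)))) * X.flow t₀ f t z :=
  X.lintegral_kernel t₀ t z f

theorem measurable_evol {f : Z → ℝ≥0∞} (hf : Measurable f) (t₀ t : ℝ) :
    Measurable (X.evol t₀ f t) := by
  simp_rw [funext fun z => X.evol_eq t₀ f t z]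
  exact (X.measurable_flow_right hf t₀ t).const_mul _

theorem lintegral_evol [SFinite μ] {f : Z → ℝ≥0∞} (hf : Measurable f) {t₀ t : ℝ} (h : t₀ ≤ t) :
    ∫⁻ z, X.evol t₀ f t z ∂μ = ∫⁻ z, f z ∂μ :=
  X.lintegral_lintegral_kernel hf h

theorem evol_comp {f : Z → ℝ≥0∞} (hf : Measurable f) {t₀ t₁ t : ℝ} (h₀ : t₀ ≤ t₁) (h₁ : t₁ ≤ t)
    (z : Z) : X.evol t₀ f t z = X.evol t₁ (X.evol t₀ f t₁) t z := by
  rw [X.evol_eq t₀ f t, X.flow_comp hf h₀ h₁, evol]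
  simp_rw [X.evol_eq t₀ f t₁]
  rw [lintegral_const_mul _ (X.measurable_flow_right hf t₀ t₁), X.lintegral_kernel, ← mul_assoc,
    ← ENNReal.ofReal_mul (Real.exp_nonneg _), ← Real.exp_add]
  congr 3
  ring_nf

theorem evol_self {f : Z → ℝ≥0∞} (hf : Measurable f) (t : ℝ) (z : Z) : X.evol t f t z = f z := by
  simp [X.evol_eq, X.flow_self hf le_rfl]

/-- Doeblin's argument in `L^p`: if the transition probabilities all dominate `c • μ`, then two
densities of the same mass get closer in `L^p` by the factor `1 - c * μ univ`. Indeed the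
remainder `kernel - c • μ` acts on their difference in the same way as the transition
probability, and both its mass and its `μ`-average are smaller by that factor. -/
theorem lintegral_gap_evol_le_mul [IsFiniteMeasure μ] {p : ℝ} (hp : 1 < p) {c : ℝ≥0} {t₀ t : ℝ}
    (h : t₀ ≤ t) (hc : ∀ z, c • μ ≤ X.kernel t₀ t z) {f g : Z → ℝ≥0∞} (hf : Measurable f)
    (hg : Measurable g) (hfg : ∫⁻ z, f z ∂μ = ∫⁻ z, g z ∂μ) (hf' : ∫⁻ z, f z ∂μ ≠ ∞)
    (hd : ∫⁻ z, gap (f z) (g z) ^ p ∂μ ≠ ∞) :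
    ∫⁻ z, gap (X.evol t₀ f t z) (X.evol t₀ g t z) ^ p ∂μ ≤
      (1 - c * μ univ) ^ p * ∫⁻ z, gap (f z) (g z) ^ p ∂μ := by
  simp only [evol]
  have hP := fun z => X.isProbabilityMeasure_kernel h z
  set κ : Z → Measure Z := fun z => X.kernel t₀ t z - c • μ with hκ
  have hsplit : ∀ z, X.kernel t₀ t z = κ z + c • μ := fun z =>
    (Measure.sub_add_cancel_of_le (hc z)).symm
  have hint : ∀ (φ : Z → ℝ≥0∞) z,
      ∫⁻ y, φ y ∂X.kernel t₀ t z = ∫⁻ y, φ y ∂κ z + c * ∫⁻ y, φ y ∂μ := fun φ z => by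
    rw [hsplit, lintegral_add_measure, lintegral_smul_measure]
    rfl
  have hmass : ∀ z, κ z univ = 1 - c * μ univ := fun z => by
    rw [hκ]
    simp only
    rw [Measure.sub_apply MeasurableSet.univ (hc z), (hP z).measure_univ]
    rfl
  have hgm := measurable_gap hf hg
  have hsub : ∀ {φ ψ : Z → ℝ≥0∞}, Measurable φ → Measurable ψ → ∀ z,
      ∫⁻ y, φ y ∂κ z - ∫⁻ y, ψ y ∂κ z ≤ ∫⁻ y, (φ y - ψ y) ∂κ z := fun {φ ψ} hφ hψ z =>
    lintegral_sub_le' _ _ hψ.aemeasurable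
  -- The parts `c * ∫ f` and `c * ∫ g` cancel, so that only the remainder `κ z` is left.
  have hpt : ∀ z, gap (∫⁻ y, f y ∂X.kernel t₀ t z) (∫⁻ y, g y ∂X.kernel t₀ t z) ≤
      ∫⁻ y, gap (f y) (g y) ∂κ z := fun z => by
    have hfin : (c : ℝ≥0∞) * ∫⁻ y, g y ∂μ ≠ ∞ := ENNReal.mul_ne_top ENNReal.coe_ne_top (hfg ▸ hf')
    rw [hint, hint, hfg, gap, ENNReal.add_sub_add_eq_sub_right hfin,
      ENNReal.add_sub_add_eq_sub_right hfin]
    simp only [gap]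
    rw [lintegral_add_left (f := fun y => f y - g y) (hf.sub hg)]
    exact add_le_add (hsub hf hg z) (hsub hg hf z)
  set Φ : Z → ℝ≥0∞ := fun z => gap (f z) (g z) ^ p with hΦ
  have hΦm : Measurable Φ := hgm.pow_const p
  have hκΦ : ∀ z, ∫⁻ y, Φ y ∂κ z = ∫⁻ y, Φ y ∂X.kernel t₀ t z - c * ∫⁻ y, Φ y ∂μ := fun z => by
    rw [hint, ENNReal.add_sub_cancel_right (ENNReal.mul_ne_top ENNReal.coe_ne_top hd)]
  have hkm : Measurable fun z => ∫⁻ y, Φ y ∂X.kernel t₀ t z := by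
    simp_rw [X.lintegral_kernel]
    exact (X.measurable_flow_right hΦm t₀ t).const_mul _
  have havg : ∫⁻ z, ∫⁻ y, Φ y ∂κ z ∂μ = (1 - c * μ univ) * ∫⁻ y, Φ y ∂μ := by
    simp_rw [hκΦ]
    rw [lintegral_sub measurable_const, X.lintegral_lintegral_kernel hΦm h, lintegral_const,
      ENNReal.sub_mul fun _ _ => hd, one_mul]
    · congr 1
      ring
    · rw [lintegral_const]
      exact ENNReal.mul_ne_top (ENNReal.mul_ne_top ENNReal.coe_ne_top hd) (measure_ne_top _ _)
    · exact ae_of_all _ fun z => by simp only [hint]; exact le_add_self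
  calc ∫⁻ z, gap (∫⁻ y, f y ∂X.kernel t₀ t z) (∫⁻ y, g y ∂X.kernel t₀ t z) ^ p ∂μ
      ≤ ∫⁻ z, (1 - c * μ univ) ^ (p - 1) * ∫⁻ y, Φ y ∂κ z ∂μ := by
        refine lintegral_mono fun z => ?_
        refine (ENNReal.rpow_le_rpow (hpt z) (by linarith)).trans ?_
        refine (lintegral_rpow_le _ hp hgm.aemeasurable).trans_eq ?_
        rw [hmass]
    _ = (1 - c * μ univ) ^ (p - 1) * ((1 - c * μ univ) * ∫⁻ y, Φ y ∂μ) := by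
        rw [lintegral_const_mul, havg]
        simp_rw [hκΦ]
        exact hkm.sub measurable_const
    _ = (1 - c * μ univ) ^ p * ∫⁻ y, Φ y ∂μ := by
        rw [← mul_assoc]
        congr 1
        nth_rewrite 2 [← ENNReal.rpow_one (1 - c * μ univ)]
        rw [← ENNReal.rpow_add_of_nonneg _ _ (by linarith) zero_le_one]
        congr 1
        ring

/-- The `L^p` distance of two evolutions of the same mass does not increase. -/
theorem lintegral_gap_evol_le [IsFiniteMeasure μ] {p : ℝ} (hp : 1 < p) {t₀ t : ℝ}
    (h : t₀ ≤ t) {f g : Z → ℝ≥0∞} (hf : Measurable f)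
    (hg : Measurable g) (hfg : ∫⁻ z, f z ∂μ = ∫⁻ z, g z ∂μ) (hf' : ∫⁻ z, f z ∂μ ≠ ∞)
    (hd : ∫⁻ z, gap (f z) (g z) ^ p ∂μ ≠ ∞) :
    ∫⁻ z, gap (X.evol t₀ f t z) (X.evol t₀ g t z) ^ p ∂μ ≤ ∫⁻ z, gap (f z) (g z) ^ p ∂μ := by
  have := X.lintegral_gap_evol_le_mul hp h (c := 0) (fun z => by simp [Measure.zero_le]) hf hg hfg
    hf' hd
  simpa using this

/-- Geometric decay in `L^p`, by iteration of Doeblin's argument over time steps of length `τ`. -/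
theorem lintegral_gap_evol_le_pow [IsFiniteMeasure μ] {p : ℝ} (hp : 1 < p) {c : ℝ≥0} {τ : ℝ}
    (hτ : 0 ≤ τ) (hc : ∀ t₀, 0 ≤ t₀ → ∀ z, c • μ ≤ X.kernel t₀ (t₀ + τ) z)
    {f g : Z → ℝ≥0∞} (hf : Measurable f) (hg : Measurable g)
    (hfg : ∫⁻ z, f z ∂μ = ∫⁻ z, g z ∂μ) (hf' : ∫⁻ z, f z ∂μ ≠ ∞)
    (hd : ∫⁻ z, gap (f z) (g z) ^ p ∂μ ≠ ∞) (n : ℕ) {t : ℝ} (ht : n * τ ≤ t) :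
    ∫⁻ z, gap (X.evol 0 f t z) (X.evol 0 g t z) ^ p ∂μ ≤
      ((1 - c * μ univ) ^ p) ^ n * ∫⁻ z, gap (f z) (g z) ^ p ∂μ := by
  induction n generalizing t with
  | zero => simpa using X.lintegral_gap_evol_le hp (by simpa using ht) hf hg hfg hf' hd
  | succ n ih =>
    have h0 : 0 ≤ n * τ := by positivity
    have h1 : n * τ ≤ n * τ + τ := by linarith
    have h2 : n * τ + τ ≤ t := by push_cast at ht; linarith
    have hm : ∀ {φ : Z → ℝ≥0∞} {s : ℝ}, Measurable φ → Measurable (X.evol 0 φ s) :=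
      fun hφ => X.measurable_evol hφ 0 _
    have heq : ∀ s : ℝ, 0 ≤ s → ∫⁻ z, X.evol 0 f s z ∂μ = ∫⁻ z, X.evol 0 g s z ∂μ := fun s hs => by
      rw [X.lintegral_evol hf hs, X.lintegral_evol hg hs, hfg]
    have hfin : ∀ s : ℝ, 0 ≤ s → ∫⁻ z, X.evol 0 f s z ∂μ ≠ ∞ := fun s hs => by
      rwa [X.lintegral_evol hf hs]
    have hfin' : ∀ s : ℝ, 0 ≤ s → ∫⁻ z, gap (X.evol 0 f s z) (X.evol 0 g s z) ^ p ∂μ ≠ ∞ :=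
      fun s hs => ne_top_of_le_ne_top hd (X.lintegral_gap_evol_le hp hs hf hg hfg hf' hd)
    calc ∫⁻ z, gap (X.evol 0 f t z) (X.evol 0 g t z) ^ p ∂μ
        ≤ ∫⁻ z, gap (X.evol 0 f (n * τ + τ) z) (X.evol 0 g (n * τ + τ) z) ^ p ∂μ := by
          simp_rw [X.evol_comp hf (h0.trans h1) h2, X.evol_comp hg (h0.trans h1) h2]
          exact X.lintegral_gap_evol_le hp h2 (hm hf) (hm hg) (heq _ (h0.trans h1))
            (hfin _ (h0.trans h1)) (hfin' _ (h0.trans h1))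
      _ ≤ (1 - c * μ univ) ^ p *
          ∫⁻ z, gap (X.evol 0 f (n * τ) z) (X.evol 0 g (n * τ) z) ^ p ∂μ := by
          simp_rw [X.evol_comp hf h0 h1, X.evol_comp hg h0 h1]
          exact X.lintegral_gap_evol_le_mul hp h1 (hc _ h0) (hm hf) (hm hg) (heq _ h0)
            (hfin _ h0) (hfin' _ h0)
      _ ≤ (1 - c * μ univ) ^ p *
          (((1 - c * μ univ) ^ p) ^ n * ∫⁻ z, gap (f z) (g z) ^ p ∂μ) := by
          gcongr
          exact ih le_rfl
      _ = ((1 - c * μ univ) ^ p) ^ (n + 1) * ∫⁻ z, gap (f z) (g z) ^ p ∂μ := by ring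

end JumpProcess

/-! ### The loop, and the spreading of the particles -/

section

/-- The circle of length `2` obtained by gluing two copies of `(0, 1)` at their ends: the point
`x ∈ (0, 1)` of the copy that carries `ξ` is `x`, that of the copy that carries `ρ` is `-x`. -/
abbrev Loop : Type := AddCircle (2 : ℝ)

instance : Fact ((0 : ℝ) < 2) := ⟨two_pos⟩

/-- A measurable damping coefficient with values in `[0, 2m]`. -/
structure Damping (m : ℝ≥0) (b : ℝ → ℝ → ℝ) : Prop where
  measurable : Measurable (Function.uncurry b)
  nonneg : ∀ t x, 0 ≤ b t x
  le : ∀ t x, b t x ≤ 2 * m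

variable {m : ℝ≥0} {b : ℝ → ℝ → ℝ}

/-- The jump process of the damped system in the coordinate `z = y - t`, which is constant along
the characteristics; here `y` is the position on the loop. The norm of a point of the loop is its
position in `[0, 1]`. The damping exchanges the values at `y` and `-y`, that is, at `z` and
`-z - 2t`. -/
noncomputable def Damping.process (hb : Damping m b) :
    JumpProcess Loop (volume : Measure Loop) where
  bound := m
  jump s z := ENNReal.ofReal (b s ‖z + (s : Loop)‖ / 2)
  stay s z := ENNReal.ofReal (m - b s ‖z + (s : Loop)‖ / 2)
  refl s z := -z - ((2 * s : ℝ) : Loop)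
  measurable_jump := by
    have h : Measurable fun x : ℝ × Loop => (x.1, ‖x.2 + (x.1 : Loop)‖) := by
      refine measurable_fst.prodMk (measurable_snd.add ?_).norm
      exact (AddCircle.continuous_mk' 2).measurable.comp measurable_fst
    exact ((hb.measurable.comp h).div_const 2).ennreal_ofReal
  measurable_stay := by
    have h : Measurable fun x : ℝ × Loop => (x.1, ‖x.2 + (x.1 : Loop)‖) := by
      refine measurable_fst.prodMk (measurable_snd.add ?_).norm
      exact (AddCircle.continuous_mk' 2).measurable.comp measurable_fst
    exact (((hb.measurable.comp h).div_const 2).const_sub _).ennreal_ofReal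
  measurable_refl := by
    refine measurable_snd.neg.sub ?_
    exact (AddCircle.continuous_mk' 2).measurable.comp (measurable_fst.const_mul 2)
  stay_add_jump s z := by
    have h0 := hb.nonneg s ‖z + (s : Loop)‖
    have h1 := hb.le s ‖z + (s : Loop)‖
    rw [← ENNReal.ofReal_add (by linarith) (by linarith), sub_add_cancel,
      ENNReal.ofReal_coe_nnreal]
  measurePreserving_refl s :=
    (measurePreserving_sub_right volume ((2 * s : ℝ) : Loop)).comp
      (Measure.measurePreserving_neg volume)
  jump_refl s z := by
    have : -z - ((2 * s : ℝ) : Loop) + (s : Loop) = -(z + (s : Loop)) := by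
      rw [two_mul, AddCircle.coe_add]
      abel
    rw [this, norm_neg]

theorem norm_coe_of_mem_Icc {x : ℝ} (hx : x ∈ Icc (0 : ℝ) 1) : ‖(x : Loop)‖ = x := by
  have h := (AddCircle.norm_coe_eq_abs_iff (x := x) (2 : ℝ) two_ne_zero).2 (by
    rw [abs_of_nonneg hx.1]
    simpa using hx.2)
  rw [h, abs_of_nonneg hx.1]

theorem lintegral_comp_sub_two_mul (f : ℝ → ℝ≥0∞) (c u v : ℝ) :
    ∫⁻ s in Ioo u v, f (c - 2 * s) = 2⁻¹ * ∫⁻ x in Ioo (c - 2 * v) (c - 2 * u), f x := by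
  have him : (fun s : ℝ => c - 2 * s) '' Ioo u v = Ioo (c - 2 * v) (c - 2 * u) := by
    ext x
    constructor
    · rintro ⟨s, hs, rfl⟩
      exact ⟨by linarith [hs.2], by linarith [hs.1]⟩
    · intro hx
      exact ⟨(c - x) / 2, ⟨by linarith [hx.2], by linarith [hx.1]⟩, by ring⟩
  have h := lintegral_image_eq_lintegral_abs_deriv_mul (f := fun s : ℝ => c - 2 * s)
    (f' := fun _ => -2) measurableSet_Ioo (s := Ioo u v) (fun s _ => by
      simpa using (((hasDerivAt_id s).const_mul 2).const_sub c).hasDerivWithinAt)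
    (fun s _ s' _ hs => by simpa using hs) f
  rw [← him, h, lintegral_const_mul' _ _ ENNReal.ofReal_ne_top, ← mul_assoc]
  simp [ENNReal.inv_mul_cancel]

/-- The particles that jump once, in the damped interval, spread over an interval. The time step
`4` is long enough for the particle to cross the damped interval in one piece. -/
theorem Damping.le_evol (hb : Damping m b) {l ε x₀ : ℝ}
    (hI : Ioo (x₀ - ε) (x₀ + ε) ⊆ Ioo (0 : ℝ) 1)
    (hbl : ∀ t, 0 < t → ∀ x ∈ Ioo (x₀ - ε) (x₀ + ε), l ≤ b t x) (hε : 0 < ε)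
    {t₀ : ℝ} (ht₀ : 0 ≤ t₀) {f : Loop → ℝ≥0∞} (hf : Measurable f) (z : ℝ) :
    ENNReal.ofReal (Real.exp (-(m * 4)) * (l / 4)) *
        ∫⁻ x in Ioc (z - 2 * x₀ - 2 * ε) (z - 2 * x₀ + 2 * ε), f (x : Loop) ≤
      hb.process.evol t₀ f (t₀ + 4) z := by
  have hlo : 0 ≤ x₀ - ε ∧ x₀ + ε ≤ 1 := (Ioo_subset_Ioo_iff (by linarith)).1 hI
  -- The damped interval, unfolded in time along the trajectory of `z`, inside `(t₀, t₀ + 4)`.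
  obtain ⟨k, hk₀, hk₁⟩ : ∃ k : ℤ, t₀ ≤ 2 * k - z ∧ 2 * k - z < t₀ + 2 :=
    ⟨⌈(t₀ + z) / 2⌉, by linarith [Int.le_ceil ((t₀ + z) / 2)],
      by linarith [Int.ceil_lt_add_one ((t₀ + z) / 2)]⟩
  set J := Ioo (2 * k - z + (x₀ - ε)) (2 * k - z + (x₀ + ε)) with hJ
  have hJs : J ⊆ Ioc t₀ (t₀ + 4) := fun s hs => ⟨by linarith [hs.1], by linarith [hs.2]⟩
  have hcoe : ∀ x : ℝ, ((x + 2 * k : ℝ) : Loop) = x := fun x => by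
    rw [AddCircle.coe_add, mul_comm, ← zsmul_eq_mul, AddCircle.coe_zsmul, AddCircle.coe_period]
    simp
  have hjump : ∀ s ∈ J, ENNReal.ofReal (l / 2) ≤ hb.process.jump s z := fun s hs => by
    refine ENNReal.ofReal_le_ofReal ?_
    have hmem : z + s - 2 * k ∈ Ioo (x₀ - ε) (x₀ + ε) := ⟨by linarith [hs.1], by linarith [hs.2]⟩
    have e : (z : Loop) + (s : Loop) = ((z + s - 2 * k : ℝ) : Loop) := by
      rw [← hcoe (z + s - 2 * k), ← AddCircle.coe_add]
      congr 1
      ring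
    rw [e, norm_coe_of_mem_Icc (Ioo_subset_Icc_self (hI hmem))]
    have := hbl s (by linarith [(hJs hs).1]) _ hmem
    linarith
  rw [JumpProcess.evol_eq, add_sub_cancel_left, ENNReal.ofReal_mul (Real.exp_nonneg _), mul_assoc]
  refine mul_le_mul_right ?_ _
  calc ENNReal.ofReal (l / 4) *
        ∫⁻ x in Ioc (z - 2 * x₀ - 2 * ε) (z - 2 * x₀ + 2 * ε), f (x : Loop)
      = ENNReal.ofReal (l / 2) * ∫⁻ s in J, f ((-z + 4 * k - 2 * s : ℝ) : Loop) := by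
        rw [hJ, lintegral_comp_sub_two_mul (fun x : ℝ => f (x : Loop)), ← mul_assoc,
          restrict_Ioo_eq_restrict_Ioc]
        congr 2
        · rw [← div_eq_mul_inv, show l / 4 = l / 2 / 2 by ring,
            ENNReal.ofReal_div_of_pos two_pos, ENNReal.ofReal_ofNat]
        · congr 2 <;> ring
    _ = ∫⁻ s in J, ENNReal.ofReal (l / 2) * f ((-z + 4 * k - 2 * s : ℝ) : Loop) := by
        rw [lintegral_const_mul' _ _ ENNReal.ofReal_ne_top]
    _ ≤ ∫⁻ s in J, (hb.process.stay s z * hb.process.flow t₀ f s z +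
          hb.process.jump s z * hb.process.flow t₀ f s (hb.process.refl s z)) := by
        refine setLIntegral_mono' measurableSet_Ioo fun s hs => ?_
        refine le_trans ?_ le_add_self
        refine mul_le_mul' (hjump s hs) (le_trans (le_of_eq ?_) (hb.process.le_flow hf _ _ _))
        congr 1
        change _ = -(z : Loop) - ((2 * s : ℝ) : Loop)
        rw [← AddCircle.coe_neg, ← AddCircle.coe_sub, ← hcoe (-z - 2 * s),
          ← hcoe (-z - 2 * s + 2 * k)]
        congr 1
        ring
    _ ≤ ∫⁻ s in Ioc t₀ (t₀ + 4), (hb.process.stay s z * hb.process.flow t₀ f s z +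
          hb.process.jump s z * hb.process.flow t₀ f s (hb.process.refl s z)) :=
        lintegral_mono_set hJs
    _ ≤ hb.process.flow t₀ f (t₀ + 4) z := by
        rw [hb.process.flow_eq hf t₀ (t₀ + 4)]
        exact le_add_self

/-- After `n + 1` jumps the particles have spread over an interval of length `2 * (n + 2) * ε`. -/
theorem Damping.le_evol_iterate (hb : Damping m b) {l ε x₀ : ℝ}
    (hI : Ioo (x₀ - ε) (x₀ + ε) ⊆ Ioo (0 : ℝ) 1)
    (hbl : ∀ t, 0 < t → ∀ x ∈ Ioo (x₀ - ε) (x₀ + ε), l ≤ b t x) (hε : 0 < ε)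
    (n : ℕ) {t₀ : ℝ} (ht₀ : 0 ≤ t₀) {f : Loop → ℝ≥0∞}
    (hf : Measurable f) (z : ℝ) :
    ENNReal.ofReal (Real.exp (-(m * 4)) * (l / 4)) ^ (n + 1) * ENNReal.ofReal ε ^ n *
        ∫⁻ x in Ioc (z - 2 * (n + 1) * x₀ - (n + 2) * ε) (z - 2 * (n + 1) * x₀ + (n + 2) * ε),
          f (x : Loop) ≤
      hb.process.evol t₀ f (t₀ + 4 * (n + 1)) z := by
  induction n generalizing z with
  | zero => simpa using hb.le_evol hI hbl hε ht₀ hf z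
  | succ n ih =>
    set K := ENNReal.ofReal (Real.exp (-(m * 4)) * (l / 4)) with hK
    set e := ENNReal.ofReal ε with he
    set h := (n + 2) * ε with hh
    have hh2 : 2 * ε ≤ h := by
      rw [hh]; gcongr; linarith [n.cast_nonneg (α := ℝ)]
    set G : ℝ → ℝ → ℝ≥0∞ := fun u v => ∫⁻ x in Ioc u v, f (x : Loop) with hG
    set w := z - 2 * x₀ with hw
    set d := 2 * (n + 1) * x₀ with hd
    have hGmono : ∀ {u v u' v' : ℝ}, u' ≤ u → v ≤ v' → G u v ≤ G u' v' := fun h1 h2 =>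
      lintegral_mono_set (Ioc_subset_Ioc h1 h2)
    set H : ℝ → ℝ≥0∞ := fun x => G (x - d - h) (x - d + h) with hH
    have hpiece : ∀ {u v : ℝ} {A : ℝ≥0∞}, v = u + ε → (∀ x ∈ Ioc u v, A ≤ H x) →
        e * A ≤ ∫⁻ x in Ioc u v, H x := fun {u v A} huv hA => by
      calc e * A = ∫⁻ x in Ioc u v, A := by
            rw [setLIntegral_const, Real.volume_Ioc, huv, add_sub_cancel_left, mul_comm]
        _ ≤ _ := setLIntegral_mono' measurableSet_Ioc hA
    -- The windows `[x - d - h, x - d + h]` with `x` in the leftmost (rightmost) quarter of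
    -- `(w - 2ε, w + 2ε)` all contain the left (right) part of the enlarged window.
    have hint : e * G (w - d - (h + ε)) (w - d + (h + ε)) ≤
        ∫⁻ x in Ioc (w - 2 * ε) (w + 2 * ε), H x := by
      calc e * G (w - d - (h + ε)) (w - d + (h + ε))
          ≤ e * G (w - d - (h + ε)) (w - d - 2 * ε + h) +
            e * G (w - d + 2 * ε - h) (w - d + (h + ε)) := by
            rw [← mul_add]
            gcongr
            refine (lintegral_mono_set ?_).trans (lintegral_union_le _ _ _)
            intro x hx
            rcases le_or_gt x (w - d - 2 * ε + h) with hc | hc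
            · exact Or.inl ⟨hx.1, hc⟩
            · exact Or.inr ⟨by linarith, hx.2⟩
        _ ≤ (∫⁻ x in Ioc (w - 2 * ε) (w - ε), H x) + ∫⁻ x in Ioc (w + ε) (w + 2 * ε), H x := by
            refine add_le_add
              (hpiece (u := w - 2 * ε) (v := w - ε) (by ring) fun x hx => hGmono ?_ ?_)
              (hpiece (u := w + ε) (v := w + 2 * ε) (by ring) fun x hx => hGmono ?_ ?_) <;>
              linarith [hx.1, hx.2]
        _ = ∫⁻ x in Ioc (w - 2 * ε) (w - ε) ∪ Ioc (w + ε) (w + 2 * ε), H x := by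
            rw [lintegral_union measurableSet_Ioc (Ioc_disjoint_Ioc_of_le (by linarith))]
        _ ≤ _ := by
            refine lintegral_mono_set (union_subset (Ioc_subset_Ioc ?_ ?_)
              (Ioc_subset_Ioc ?_ ?_)) <;> linarith
    have hn : (0 : ℝ) ≤ 4 * (n + 1) := by positivity
    calc K ^ (n + 1 + 1) * e ^ (n + 1) * ∫⁻ x in
          Ioc (z - 2 * ((n + 1 : ℕ) + 1) * x₀ - ((n + 1 : ℕ) + 2) * ε)
            (z - 2 * ((n + 1 : ℕ) + 1) * x₀ + ((n + 1 : ℕ) + 2) * ε), f (x : Loop)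
        = K * (K ^ (n + 1) * e ^ n * (e * G (w - d - (h + ε)) (w - d + (h + ε)))) := by
          rw [hG, hw, hd, hh, pow_succ K, pow_succ e]
          push_cast
          ring_nf
      _ ≤ K * ∫⁻ x in Ioc (w - 2 * ε) (w + 2 * ε), K ^ (n + 1) * e ^ n * H x := by
          rw [lintegral_const_mul' _ _ (by finiteness)]
          gcongr
      _ ≤ K * ∫⁻ x in Ioc (w - 2 * ε) (w + 2 * ε),
            hb.process.evol t₀ f (t₀ + 4 * (n + 1)) (x : Loop) := by
          gcongr with x
          exact ih x
      _ ≤ hb.process.evol (t₀ + 4 * (n + 1))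
            (hb.process.evol t₀ f (t₀ + 4 * (n + 1))) (t₀ + 4 * (n + 1) + 4) z :=
          hb.le_evol hI hbl hε (by linarith) (hb.process.measurable_evol hf _ _) z
      _ = hb.process.evol t₀ f (t₀ + 4 * ((n + 1 : ℕ) + 1)) z := by
          rw [← hb.process.evol_comp hf (by linarith) (by linarith)]
          congr 1
          push_cast
          ring

/-- Doeblin's minorization: within a time that depends only on `ε`, the particles have spread over
the whole loop, with a density that depends only on `m`, `l` and `ε`. -/
theorem exists_smul_volume_le_kernel (m : ℝ≥0) {l ε : ℝ} (hl : 0 < l) (hε : 0 < ε) :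
    ∃ c : ℝ≥0, 0 < c ∧ c ≤ 1 / 4 ∧ ∃ τ : ℝ, 0 < τ ∧
      ∀ (b : ℝ → ℝ → ℝ) (hb : Damping m b) (x₀ : ℝ), Ioo (x₀ - ε) (x₀ + ε) ⊆ Ioo (0 : ℝ) 1 →
        (∀ t, 0 < t → ∀ x ∈ Ioo (x₀ - ε) (x₀ + ε), l ≤ b t x) →
        ∀ t₀, 0 ≤ t₀ → ∀ z, c • volume ≤ hb.process.kernel t₀ (t₀ + τ) z := by
  obtain ⟨n, hn⟩ := exists_nat_ge (1 / ε)
  have hnε : 1 ≤ (n + 2) * ε := by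
    rw [div_le_iff₀ hε] at hn
    linarith
  set K : ℝ := (Real.exp (-(m * 4)) * (l / 4)) ^ (n + 1) * ε ^ n with hK
  have hK0 : 0 < K := by positivity
  refine ⟨min K.toNNReal (1 / 4), by simp [hK0], min_le_right _ _, 4 * (n + 1), by positivity,
    fun b hb x₀ hI hbl t₀ ht₀ z => Measure.le_iff.2 fun s hs => ?_⟩
  obtain ⟨z, rfl⟩ := QuotientAddGroup.mk_surjective z
  have hf : Measurable (s.indicator (1 : Loop → ℝ≥0∞)) := measurable_one.indicator hs
  have h := hb.le_evol_iterate hI hbl hε n ht₀ hf z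
  calc (min K.toNNReal (1 / 4) • volume : Measure Loop) s
      ≤ (K.toNNReal : ℝ≥0∞) * volume s := by
        rw [Measure.smul_apply, ENNReal.smul_def, smul_eq_mul]
        gcongr
        exact min_le_left _ _
    _ = ENNReal.ofReal (Real.exp (-(m * 4)) * (l / 4)) ^ (n + 1) * ENNReal.ofReal ε ^ n *
        ∫⁻ x in Ioc (z - 2 * (n + 1) * x₀ - 1) (z - 2 * (n + 1) * x₀ - 1 + 2),
          s.indicator (1 : Loop → ℝ≥0∞) (x : Loop) := by
        rw [AddCircle.lintegral_preimage, lintegral_indicator_one hs,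
          ← ENNReal.ofReal_pow (by positivity), ← ENNReal.ofReal_pow hε.le,
          ← ENNReal.ofReal_mul (by positivity)]
        rfl
    _ ≤ _ := by
        refine le_trans ?_ (h.trans_eq ?_)
        · refine mul_le_mul' le_rfl (lintegral_mono_set (Ioc_subset_Ioc ?_ ?_)) <;> linarith
        · rw [JumpProcess.evol, lintegral_indicator_one hs]

end

/-! ### The evolution along trajectories -/

/-- The integrating factor `exp (-(m * t))`, for a primitive `v` of an integrable function `γ`. -/
theorem exp_neg_mul_primitive {γ v : ℝ → ℝ} (hγ : ∀ a b, IntervalIntegrable γ volume a b) (v₀ : ℝ)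
    (hv : ∀ t, v t = v₀ + ∫ s in (0 : ℝ)..t, γ s) (m s t : ℝ) :
    Real.exp (-(m * t)) * v t - Real.exp (-(m * s)) * v s =
      ∫ τ in s..t, Real.exp (-(m * τ)) * (γ τ - m * v τ) := by
  have hv' : v = fun t => v₀ + ∫ s in (0 : ℝ)..t, γ s := funext hv
  set L := |s| + |t| with hL
  have hs : uIcc s t ⊆ uIcc (-L) L := by
    rw [uIcc_of_le (by have := abs_nonneg s; have := abs_nonneg t; linarith : -L ≤ L)]
    refine uIcc_subset_Icc ⟨?_, ?_⟩ ⟨?_, ?_⟩ <;>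
      linarith [abs_nonneg s, abs_nonneg t, le_abs_self s, neg_abs_le s, le_abs_self t,
        neg_abs_le t]
  have h0 : (0 : ℝ) ∈ uIcc (-L) L := by
    rw [uIcc_of_le (by have := abs_nonneg s; have := abs_nonneg t; linarith : -L ≤ L)]
    constructor <;> linarith [abs_nonneg s, abs_nonneg t]
  have hvac : AbsolutelyContinuousOnInterval v s t := by
    refine AbsolutelyContinuousOnInterval.mono ?_ hs
    rw [hv']
    refine AbsolutelyContinuousOnInterval.add ?_
      ((hγ _ _).absolutelyContinuousOnInterval_intervalIntegral h0)
    exact (contDiff_const (n := 1)).contDiffOn.absolutelyContinuousOnInterval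
  have heac : AbsolutelyContinuousOnInterval (fun t => Real.exp (-(m * t))) s t := by
    refine ContDiffOn.absolutelyContinuousOnInterval (ContDiff.contDiffOn (n := 1) ?_)
    fun_prop
  rw [← heac.integral_deriv_mul_eq_sub hvac]
  refine intervalIntegral.integral_congr_ae ?_
  filter_upwards [(hγ (-L) L).ae_hasDerivAt_integral] with x hx hxm
  have h1 : HasDerivAt v (γ x) x := by
    rw [hv']
    exact (hx (hs (uIoc_subset_uIcc hxm)) 0 h0).const_add v₀
  have h2 : HasDerivAt (fun t => Real.exp (-(m * t))) (Real.exp (-(m * x)) * -m) x := by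
    have : HasDerivAt (fun t => -(m * t)) (-m) x := by
      simpa using HasDerivAt.fun_neg ((hasDerivAt_id' x).const_mul m)
    exact this.exp
  rw [h1.deriv, h2.deriv]
  ring

namespace JumpProcess

variable {Z : Type*} [MeasurableSpace Z] {μ : Measure Z} (X : JumpProcess Z μ)
  {f : Z → ℝ≥0∞}

theorem ae_flow_ne_top [SFinite μ] (hf : Measurable f) (hfi : ∫⁻ z, f z ∂μ ≠ ∞) :
    ∀ᵐ z ∂μ, ∀ t, X.flow 0 f t z ≠ ∞ := by
  have h : ∀ n : ℕ, ∀ᵐ z ∂μ, X.flow 0 f n z < ∞ := fun n => by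
    refine ae_lt_top (X.measurable_flow_right hf 0 n) ?_
    rw [X.lintegral_flow hf n.cast_nonneg]
    exact ENNReal.mul_ne_top ENNReal.ofReal_ne_top hfi
  filter_upwards [ae_all_iff.2 h] with z hz t
  obtain ⟨n, hn⟩ := exists_nat_ge t
  exact ne_top_of_le_ne_top (hz n).ne (X.flow_mono hf 0 hn z)

/-- The real form of the integral equation of the flow, at a point where the flow is finite. -/
theorem exists_primitive_flow (hf : Measurable f) {z : Z} (hz : ∀ t, X.flow 0 f t z ≠ ∞) :
    ∃ γ : ℝ → ℝ, (∀ a b, IntervalIntegrable γ volume a b) ∧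
      (∀ t, (X.flow 0 f t z).toReal = (f z).toReal + ∫ s in (0 : ℝ)..t, γ s) ∧
      ∀ᵐ s, 0 < s → γ s = (X.stay s z).toReal * (X.flow 0 f s z).toReal +
        (X.jump s z).toReal * (X.flow 0 f s (X.refl s z)).toReal := by
  set G : ℝ → ℝ≥0∞ := fun s => X.stay s z * X.flow 0 f s z +
    X.jump s z * X.flow 0 f s (X.refl s z) with hG
  have hGm : Measurable G :=
    (X.measurable_apply_generator (X.measurable_flow hf 0)).comp measurable_prodMk_right
  have hGi : ∀ t, ∫⁻ s in Ioc 0 t, G s ≠ ∞ := fun t => by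
    refine ne_top_of_le_ne_top (hz t) ?_
    rw [X.flow_eq hf 0 t]
    exact le_add_self
  have hcut : ∀ t, ∫⁻ s in Iic t, (Ioi 0).indicator G s = ∫⁻ s in Ioc 0 t, G s := fun t => by
    rw [lintegral_indicator measurableSet_Ioi, Measure.restrict_restrict measurableSet_Ioi]
    rfl
  set γ : ℝ → ℝ := fun s => ((Ioi 0).indicator G s).toReal with hγ
  have hint : ∀ t, IntegrableOn γ (Iic t) := fun t =>
    integrable_toReal_of_lintegral_ne_top (hGm.indicator measurableSet_Ioi).aemeasurable
      (by rw [hcut]; exact hGi t)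
  have hγi : ∀ a b, IntervalIntegrable γ volume a b := fun a b => by
    rw [intervalIntegrable_iff]
    exact (hint (max a b)).mono_set fun x hx => hx.2
  refine ⟨γ, hγi, fun t => ?_, ?_⟩
  · have hneg : ∀ s ≤ 0, γ s = 0 := fun s hs => by
      simp [hγ, indicator_of_notMem (show s ∉ Ioi (0 : ℝ) from not_lt.2 hs)]
    rw [X.flow_eq hf, ENNReal.toReal_add (by simpa [X.flow_self hf le_rfl] using hz 0) (hGi t),
      ← integral_toReal hGm.aemeasurable]
    · congr 1
      rcases le_total 0 t with h | h
      · rw [intervalIntegral.integral_of_le h]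
        refine setIntegral_congr_fun measurableSet_Ioc fun s hs => ?_
        simp [hγ, indicator_of_mem (show s ∈ Ioi (0 : ℝ) from hs.1)]
      · rw [intervalIntegral.integral_of_ge h, Ioc_eq_empty (not_lt.2 h)]
        rw [setIntegral_congr_fun measurableSet_Ioc fun s hs => hneg s hs.2]
        simp
    · exact ae_lt_top hGm (hGi t)
  · have hfin : ∀ n : ℕ, ∀ᵐ s, s ∈ Ioc (0 : ℝ) n → G s < ∞ := fun n =>
      (ae_restrict_iff' measurableSet_Ioc).1 (ae_lt_top hGm (hGi n))
    filter_upwards [ae_all_iff.2 hfin] with s hs h0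
    obtain ⟨n, hn⟩ := exists_nat_ge s
    have h := hs n ⟨h0, hn⟩
    rw [hγ]
    simp only
    rw [indicator_of_mem (show s ∈ Ioi (0 : ℝ) from h0), hG]
    simp only
    rw [ENNReal.toReal_add, ENNReal.toReal_mul, ENNReal.toReal_mul]
    · exact ne_top_of_le_ne_top h.ne le_self_add
    · exact ne_top_of_le_ne_top h.ne le_add_self

theorem toReal_evol (t₀ t : ℝ) (z : Z) : (X.evol t₀ f t z).toReal =
    Real.exp (-(X.bound * (t - t₀))) * (X.flow t₀ f t z).toReal := by
  rw [X.evol_eq, ENNReal.toReal_mul, ENNReal.toReal_ofReal (Real.exp_nonneg _)]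

theorem continuous_toReal_evol (hf : Measurable f) {z : Z} (hz : ∀ t, X.flow 0 f t z ≠ ∞) :
    Continuous fun t => (X.evol 0 f t z).toReal := by
  obtain ⟨γ, hγ, hv, -⟩ := X.exists_primitive_flow hf hz
  simp_rw [X.toReal_evol, hv]
  have := intervalIntegral.continuous_primitive hγ 0
  fun_prop

/-- The evolution solves the jump equation along the trajectory of almost every point. -/
theorem toReal_evol_sub (hf : Measurable f) {z : Z} (hz : ∀ t, X.flow 0 f t z ≠ ∞)
    {s t : ℝ} (hs : 0 ≤ s) (hst : s ≤ t) :
    IntervalIntegrable (fun τ => (X.jump τ z).toReal *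
      ((X.evol 0 f τ (X.refl τ z)).toReal - (X.evol 0 f τ z).toReal)) volume s t ∧
    (X.evol 0 f t z).toReal - (X.evol 0 f s z).toReal = ∫ τ in s..t, (X.jump τ z).toReal *
      ((X.evol 0 f τ (X.refl τ z)).toReal - (X.evol 0 f τ z).toReal) := by
  obtain ⟨γ, hγ, hv, hγe⟩ := X.exists_primitive_flow hf hz
  have key : ∀ᵐ τ, τ ∈ uIoc s t → Real.exp (-(X.bound * τ)) *
      (γ τ - X.bound * (X.flow 0 f τ z).toReal) = (X.jump τ z).toReal *
      ((X.evol 0 f τ (X.refl τ z)).toReal - (X.evol 0 f τ z).toReal) := by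
    filter_upwards [hγe] with τ h hτ
    rw [uIoc_of_le hst] at hτ
    have hsum := X.stay_add_jump τ z
    have hb : (X.bound : ℝ) = (X.stay τ z).toReal + (X.jump τ z).toReal := by
      rw [← ENNReal.toReal_add, hsum, ENNReal.coe_toReal]
      · exact ne_top_of_le_ne_top ENNReal.coe_ne_top (hsum ▸ le_self_add)
      · exact ne_top_of_le_ne_top ENNReal.coe_ne_top (hsum ▸ le_add_self)
    rw [h (hs.trans_lt hτ.1), X.toReal_evol, X.toReal_evol, sub_zero]
    set E := Real.exp (-(X.bound * τ))
    rw [hb]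
    ring
  have hcont : Continuous fun t => (X.flow 0 f t z).toReal := by
    simp_rw [hv]
    have := intervalIntegral.continuous_primitive hγ 0
    fun_prop
  constructor
  · refine IntervalIntegrable.congr_ae (f := fun τ => Real.exp (-(X.bound * τ)) *
      (γ τ - X.bound * (X.flow 0 f τ z).toReal)) ?_ ((ae_restrict_iff' measurableSet_uIoc).2 key)
    refine ((hγ s t).sub ?_).continuousOn_mul (Continuous.continuousOn (by fun_prop))
    exact (hcont.const_mul _).intervalIntegrable _ _
  · rw [← intervalIntegral.integral_congr_ae key, X.toReal_evol, X.toReal_evol, sub_zero, sub_zero]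
    exact exp_neg_mul_primitive hγ _ hv _ _ _

/-- The evolution is a contraction of `L^p`, in the form that bounds all times up to `T` at
once. -/
theorem lintegral_flow_rpow_ne_top [SFinite μ] {p : ℝ} (hp : 1 < p) (hf : Measurable f)
    (hfp : ∫⁻ z, f z ^ p ∂μ ≠ ∞) {T : ℝ} (hT : 0 ≤ T) :
    ∫⁻ z, X.flow 0 f T z ^ p ∂μ ≠ ∞ := by
  have hle : ∀ z, X.evol 0 f T z ^ p ≤ X.evol 0 (fun y => f y ^ p) T z := fun z => by
    have := X.isProbabilityMeasure_kernel hT z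
    simpa [evol] using lintegral_rpow_le (X.kernel 0 T z) hp hf.aemeasurable
  have hflow : ∀ z, X.flow 0 f T z =
      ENNReal.ofReal (Real.exp (X.bound * T)) * X.evol 0 f T z := fun z => by
    rw [X.evol_eq, ← mul_assoc, sub_zero, mul_comm (ENNReal.ofReal _), ofReal_exp_neg_mul, one_mul]
  have h0 : (0 : ℝ) ≤ p := by linarith
  simp_rw [hflow, ENNReal.mul_rpow_of_nonneg _ _ h0]
  rw [lintegral_const_mul _ ((X.measurable_evol hf 0 T).pow_const p)]
  refine ENNReal.mul_ne_top (ENNReal.rpow_ne_top_of_nonneg h0 ENNReal.ofReal_ne_top) ?_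
  refine ne_top_of_le_ne_top hfp ((lintegral_mono hle).trans_eq ?_)
  exact X.lintegral_evol (hf.pow_const p) hT

end JumpProcess

/-! ### Continuous maps into `L^p` -/

/-- Dominated convergence in `L^p`, for a family of functions with a continuous parameter. -/
theorem tendsto_eLpNorm_of_dominated {p : ℝ≥0∞} (hp0 : p ≠ 0) (hp : p ≠ ∞) {F : ℝ → ℝ → ℝ}
    {G : ℝ → ℝ} (hF : ∀ y, AEStronglyMeasurable (F y) volume) (hG : MemLp G p volume)
    (hbound : ∀ᵐ z, ∀ y, ‖F y z‖ ≤ G z) (hcont : ∀ᵐ z, Continuous fun y => F y z) (y₀ : ℝ) :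
    Tendsto (fun y => eLpNorm (fun z => F y z - F y₀ z) p volume) (𝓝 y₀) (𝓝 0) := by
  have hp1 : 0 < p.toReal := ENNReal.toReal_pos hp0 hp
  simp_rw [eLpNorm_eq_lintegral_rpow_enorm_toReal hp0 hp]
  have hlim : Tendsto (fun y => ∫⁻ z, ‖F y z - F y₀ z‖ₑ ^ p.toReal) (𝓝 y₀)
      (𝓝 (∫⁻ _ : ℝ, 0)) := by
    refine tendsto_lintegral_filter_of_dominated_convergence'
      (fun z => (2 * ‖G z‖ₑ) ^ p.toReal) ?_ ?_ ?_ ?_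
    · exact Eventually.of_forall fun y => (((hF y).sub (hF y₀)).enorm).pow_const _
    · refine Eventually.of_forall fun y => ?_
      filter_upwards [hbound] with z hz
      refine ENNReal.rpow_le_rpow ?_ hp1.le
      have h : ∀ y, ‖F y z‖ₑ ≤ ‖G z‖ₑ := fun y =>
        enorm_le_iff_norm_le.2 ((hz y).trans (le_abs_self _))
      exact enorm_sub_le.trans (by rw [two_mul]; exact add_le_add (h y) (h y₀))
    · simp_rw [ENNReal.mul_rpow_of_nonneg _ _ hp1.le]
      rw [lintegral_const_mul']
      · refine ENNReal.mul_ne_top (by finiteness) ?_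
        have := (lintegral_rpow_enorm_lt_top_of_eLpNorm_lt_top hp0 hp hG.2).ne
        exact this
      · finiteness
    · filter_upwards [hcont] with z hz
      have : Tendsto (fun y => ‖F y z - F y₀ z‖ₑ ^ p.toReal) (𝓝 y₀)
          (𝓝 (‖F y₀ z - F y₀ z‖ₑ ^ p.toReal)) :=
        (ENNReal.continuous_rpow_const.comp ((hz.sub continuous_const).enorm)).tendsto y₀
      simpa [hp1] using this
  rw [lintegral_zero] at hlim
  have := (ENNReal.continuous_rpow_const (y := 1 / p.toReal)).tendsto 0 |>.comp hlim
  simpa [hp1, Function.comp_def] using this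

/-- Joint continuity of the action of measure-preserving maps on `L^p`, for functions that depend
on a parameter in the sense of dominated convergence. -/
theorem continuousIntoLp_comp {p : ℝ≥0∞} (hp1 : 1 ≤ p) (hp : p ≠ ∞) {F : ℝ → ℝ → ℝ}
    {G : ℝ → ℝ} (hF : ∀ y, AEStronglyMeasurable (F y) volume) (hG : MemLp G p volume)
    (hbound : ∀ᵐ z, ∀ y, ‖F y z‖ ≤ G z) (hcont : ∀ᵐ z, Continuous fun y => F y z)
    (g : ℝ → C(ℝ, ℝ)) (hg : Continuous g) (hgm : ∀ y, MeasurePreserving (g y) volume volume)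
    (I : Set ℝ) :
    ContinuousIntoLp p volume I (fun y z => F y (g y z)) := by
  have hmem : ∀ y, MemLp (F y) p volume := fun y =>
    hG.mono (hF y) (hbound.mono fun z hz => (hz y).trans (le_abs_self _))
  have : Fact (1 ≤ p) := ⟨hp1⟩
  have hp0 : p ≠ 0 := (one_pos.trans_le hp1).ne'
  refine ⟨fun y _ => (hmem y).comp_measurePreserving (hgm y), fun y₀ _ => ?_⟩
  refine Tendsto.mono_left ?_ nhdsWithin_le_nhds
  have h1 : Tendsto (fun y => (hmem y).toLp) (𝓝 y₀) (𝓝 (hmem y₀).toLp) :=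
    Lp.tendsto_Lp_iff_tendsto_eLpNorm'' _ _ _ _ |>.2
      (tendsto_eLpNorm_of_dominated hp0 hp hF hG hbound hcont y₀)
  have h2 := h1.compMeasurePreservingLp (hg.tendsto y₀) hgm (hgm y₀) hp
  rw [Lp.tendsto_Lp_iff_tendsto_eLpNorm'] at h2
  refine h2.congr fun y => eLpNorm_congr_ae ?_
  have e : ∀ y, (Lp.compMeasurePreserving (g y) (hgm y) (hmem y).toLp : ℝ → ℝ) =ᵐ[volume]
      fun z => F y (g y z) := fun y =>
    (Lp.coeFn_compMeasurePreserving _ (hgm y)).trans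
      ((hgm y).quasiMeasurePreserving.ae_eq_comp (hmem y).coeFn_toLp)
  filter_upwards [e y, e y₀] with z h h₀
  rw [Pi.sub_apply, h, h₀]

theorem ContinuousIntoLp.restrict_congr {p : ℝ≥0∞} {I J : Set ℝ} {F u : ℝ → ℝ → ℝ}
    (hF : ContinuousIntoLp p volume I F) (hJ : MeasurableSet J)
    (h : ∀ y ∈ I, ∀ z ∈ J, u y z = F y z) :
    ContinuousIntoLp p (volume.restrict J) I u := by
  have hae : ∀ y ∈ I, u y =ᵐ[volume.restrict J] F y := fun y hy =>
    (ae_restrict_iff' hJ).2 (ae_of_all _ fun z hz => h y hy z hz)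
  refine ⟨fun y hy => ((hF.1 y hy).restrict J).ae_eq (hae y hy).symm, fun y₀ hy₀ => ?_⟩
  refine tendsto_of_tendsto_of_tendsto_of_le_of_le' tendsto_const_nhds (hF.2 y₀ hy₀)
    (Eventually.of_forall fun _ => bot_le) ?_
  filter_upwards [self_mem_nhdsWithin] with y hy
  refine (eLpNorm_congr_ae ?_).trans_le (eLpNorm_mono_measure _ Measure.restrict_le_self)
  filter_upwards [hae y hy, hae y₀ hy₀] with z h h₀
  rw [h, h₀]

theorem ContinuousIntoLp.const_add {p : ℝ≥0∞} {μ : Measure ℝ} [IsFiniteMeasure μ] {I : Set ℝ}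
    {u : ℝ → ℝ → ℝ} (hu : ContinuousIntoLp p μ I u) (c : ℝ) :
    ContinuousIntoLp p μ I (fun y z => c + u y z) := by
  refine ⟨fun y hy => (memLp_const c).add (hu.1 y hy), fun y₀ hy₀ => ?_⟩
  simpa using hu.2 y₀ hy₀

theorem lintegral_Ioc_coe_loop (φ : Loop → ℝ≥0∞) (a : ℝ) (n : ℕ) :
    ∫⁻ x in Ioc a (a + 2 * n), φ (x : Loop) = n * ∫⁻ z, φ z := by
  induction n with
  | zero => simp
  | succ n ih =>
    have h1 : a ≤ a + 2 * n := by simp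
    have h2 : a + 2 * n ≤ a + 2 * (n + 1 : ℕ) := by push_cast; linarith
    rw [← Ioc_union_Ioc_eq_Ioc h1 h2, lintegral_union measurableSet_Ioc
      (Ioc_disjoint_Ioc_of_le le_rfl), ih,
      show a + 2 * ((n + 1 : ℕ) : ℝ) = a + 2 * n + 2 by push_cast; ring,
      AddCircle.lintegral_preimage]
    push_cast
    ring

theorem lintegral_Icc_coe_loop_ne_top {φ : Loop → ℝ≥0∞} (hφ : ∫⁻ z, φ z ≠ ∞) (K : ℝ) :
    ∫⁻ x in Icc (-K) K, φ (x : Loop) ≠ ∞ := by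
  obtain ⟨n, hn⟩ := exists_nat_ge (K + 1)
  refine ne_top_of_le_ne_top ?_ (lintegral_mono_set (t := Ioc (-n : ℝ) (-n + 2 * n)) ?_)
  · rw [lintegral_Ioc_coe_loop]
    exact ENNReal.mul_ne_top (ENNReal.natCast_ne_top n) hφ
  · exact fun x hx => ⟨by linarith [hx.1], by linarith [hx.2]⟩

theorem quasiMeasurePreserving_coe_loop :
    Measure.QuasiMeasurePreserving (fun x : ℝ => (x : Loop)) volume volume := by
  refine ⟨AddCircle.measurable_mk', Measure.AbsolutelyContinuous.mk fun s hs h0 => ?_⟩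
  rw [Measure.map_apply AddCircle.measurable_mk' hs]
  have hn : ∀ n : ℕ, ∀ᵐ x : ℝ, x ∈ Ioc (-n : ℝ) (-n + 2 * n) → (x : Loop) ∉ s := fun n => by
    rw [← ae_restrict_iff' measurableSet_Ioc]
    have h := lintegral_Ioc_coe_loop (s.indicator 1) (-n) n
    have hm : Measurable fun x : ℝ => s.indicator (1 : Loop → ℝ≥0∞) (x : Loop) :=
      (measurable_one.indicator hs).comp AddCircle.measurable_mk'
    rw [lintegral_indicator_one hs, h0, mul_zero, lintegral_eq_zero_iff hm] at h
    filter_upwards [h] with x hx hxs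
    simp [indicator_of_mem hxs] at hx
  have hall : ∀ᵐ x : ℝ, (x : Loop) ∉ s := by
    filter_upwards [ae_all_iff.2 hn] with x hx
    obtain ⟨n, hn⟩ := exists_nat_gt |x|
    refine hx n ⟨?_, ?_⟩
    · linarith [neg_abs_le x]
    · linarith [le_abs_self x]
  simpa [ae_iff] using! hall

/-- The loop consists of the two copies of `(0, 1)`. -/
theorem lintegral_loop {φ : Loop → ℝ≥0∞} (hφ : Measurable φ) :
    ∫⁻ z, φ z = ∫⁻ x in Ioo (0 : ℝ) 1, (φ (-x : ℝ) + φ (x : ℝ)) := by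
  have hφc : Measurable fun x : ℝ => φ (x : Loop) := hφ.comp AddCircle.measurable_mk'
  have hneg : ∫⁻ x in Ioo (0 : ℝ) 1, φ ((-x : ℝ) : Loop) =
      ∫⁻ x in Ioc (-1 : ℝ) 0, φ (x : Loop) := by
    rw [← restrict_Ioo_eq_restrict_Ioc]
    have := (Measure.measurePreserving_neg (volume : Measure ℝ)).setLIntegral_comp_preimage
      (s := Ioo (-1 : ℝ) 0) measurableSet_Ioo hφc
    rw [← this]
    congr 2
    ext x
    simp
  rw [lintegral_add_right _ hφc, hneg, restrict_Ioo_eq_restrict_Ioc,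
    ← lintegral_union measurableSet_Ioc (Ioc_disjoint_Ioc_of_le le_rfl),
    Ioc_union_Ioc_eq_Ioc (by norm_num) zero_le_one, ← AddCircle.lintegral_preimage 2 (-1)]
  norm_num

/-! ### Waves on the loop -/

section

namespace JumpProcess

variable {Z : Type*} [MeasurableSpace Z] {μ : Measure Z} (X : JumpProcess Z μ)

/-- The evolution of a real initial value: the difference of those of its positive and negative
parts. -/
noncomputable def sol (h : Z → ℝ) (t : ℝ) (z : Z) : ℝ :=
  (X.evol 0 (fun y => ENNReal.ofReal (h y)) t z).toReal -
    (X.evol 0 (fun y => ENNReal.ofReal (-h y)) t z).toReal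

/-- A bound of the evolution of a real initial value up to the time `T`. -/
noncomputable def solBound (h : Z → ℝ) (T : ℝ) (z : Z) : ℝ :=
  (X.flow 0 (fun y => ENNReal.ofReal (h y)) T z).toReal +
    (X.flow 0 (fun y => ENNReal.ofReal (-h y)) T z).toReal

variable {h : Z → ℝ}

theorem measurable_ofReal_neg (hh : Measurable h) : Measurable fun z => ENNReal.ofReal (-h z) :=
  hh.neg.ennreal_ofReal

/-- The trajectories along which the evolution of `h` is finite at all times. -/
def goodSet (h : Z → ℝ) : Set Z :=
  {z | (∀ t, X.flow 0 (fun y => ENNReal.ofReal (h y)) t z ≠ ∞) ∧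
    ∀ t, X.flow 0 (fun y => ENNReal.ofReal (-h y)) t z ≠ ∞}

theorem measurable_sol (hh : Measurable h) : Measurable fun x : ℝ × Z => X.sol h x.1 x.2 := by
  have key : ∀ f : Z → ℝ≥0∞, Measurable f →
      Measurable fun x : ℝ × Z => (X.evol 0 f x.1 x.2).toReal := fun f hf => by
    simp_rw [X.toReal_evol]
    refine Measurable.mul (by fun_prop) (X.measurable_flow hf 0).ennreal_toReal
  exact (key _ hh.ennreal_ofReal).sub (key _ (measurable_ofReal_neg hh))

theorem measurable_sol_right (hh : Measurable h) (t : ℝ) : Measurable (X.sol h t) :=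
  (X.measurable_evol hh.ennreal_ofReal 0 t).ennreal_toReal.sub
    (X.measurable_evol (measurable_ofReal_neg hh) 0 t).ennreal_toReal

theorem measurable_solBound (hh : Measurable h) (T : ℝ) : Measurable (X.solBound h T) :=
  (X.measurable_flow_right hh.ennreal_ofReal 0 T).ennreal_toReal.add
    (X.measurable_flow_right (measurable_ofReal_neg hh) 0 T).ennreal_toReal

theorem ae_mem_goodSet [SFinite μ] (hh : Measurable h) (hi : Integrable h μ) :
    ∀ᵐ z ∂μ, z ∈ X.goodSet h := by
  filter_upwards [X.ae_flow_ne_top hh.ennreal_ofReal hi.lintegral_lt_top.ne,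
    X.ae_flow_ne_top (measurable_ofReal_neg hh) hi.neg.lintegral_lt_top.ne] with z h1 h2
  exact ⟨h1, h2⟩

theorem continuous_sol (hh : Measurable h) {z : Z} (hz : z ∈ X.goodSet h) :
    Continuous fun t => X.sol h t z :=
  (X.continuous_toReal_evol hh.ennreal_ofReal hz.1).sub
    (X.continuous_toReal_evol (measurable_ofReal_neg hh) hz.2)

theorem sol_zero (hh : Measurable h) (z : Z) : X.sol h 0 z = h z := by
  rw [sol, X.evol_self hh.ennreal_ofReal, X.evol_self (measurable_ofReal_neg hh)]
  rw [ENNReal.toReal_ofReal', ENNReal.toReal_ofReal']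
  rcases le_total 0 (h z) with h0 | h0 <;> simp [h0]

theorem abs_sol_le (hh : Measurable h) {z : Z} (hz : z ∈ X.goodSet h) {t T : ℝ} (ht : 0 ≤ t)
    (hT : t ≤ T) : |X.sol h t z| ≤ X.solBound h T z := by
  have key : ∀ f : Z → ℝ≥0∞, Measurable f → (∀ t, X.flow 0 f t z ≠ ∞) →
      (X.evol 0 f t z).toReal ≤ (X.flow 0 f T z).toReal := fun f hf hfz => by
    have h1 := ENNReal.toReal_mono (hfz T) (X.flow_mono hf 0 hT z)
    rw [X.toReal_evol]
    refine (mul_le_of_le_one_left ENNReal.toReal_nonneg ?_).trans h1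
    refine Real.exp_le_one_iff.2 ?_
    have : (0 : ℝ) ≤ X.bound * (t - 0) := by rw [sub_zero]; positivity
    linarith
  have h1 := key _ hh.ennreal_ofReal hz.1
  have h2 := key _ (measurable_ofReal_neg hh) hz.2
  rw [sol, solBound, abs_le]
  constructor <;> linarith
    [ENNReal.toReal_nonneg (a := X.evol 0 (fun y => ENNReal.ofReal (h y)) t z),
    ENNReal.toReal_nonneg (a := X.evol 0 (fun y => ENNReal.ofReal (-h y)) t z),
    ENNReal.toReal_nonneg (a := X.flow 0 (fun y => ENNReal.ofReal (h y)) T z),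
    ENNReal.toReal_nonneg (a := X.flow 0 (fun y => ENNReal.ofReal (-h y)) T z)]

theorem sol_sub (hh : Measurable h) {z : Z} (hz : z ∈ X.goodSet h) {s t : ℝ} (hs : 0 ≤ s)
    (hst : s ≤ t) : X.sol h t z - X.sol h s z =
      ∫ τ in s..t, (X.jump τ z).toReal * (X.sol h τ (X.refl τ z) - X.sol h τ z) := by
  obtain ⟨i1, e1⟩ := X.toReal_evol_sub hh.ennreal_ofReal hz.1 hs hst
  obtain ⟨i2, e2⟩ := X.toReal_evol_sub (measurable_ofReal_neg hh) hz.2 hs hst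
  have : X.sol h t z - X.sol h s z =
    ((X.evol 0 (fun y => ENNReal.ofReal (h y)) t z).toReal -
      (X.evol 0 (fun y => ENNReal.ofReal (h y)) s z).toReal) -
    ((X.evol 0 (fun y => ENNReal.ofReal (-h y)) t z).toReal -
      (X.evol 0 (fun y => ENNReal.ofReal (-h y)) s z).toReal) := by
    simp only [sol]
    ring
  rw [this, e1, e2, ← intervalIntegral.integral_sub i1 i2]
  refine intervalIntegral.integral_congr fun τ _ => ?_
  simp only [sol]
  ring

theorem memLp_solBound [SFinite μ] {p : ℝ≥0∞} (hp1 : 1 < p) (hp : p ≠ ∞) (hh : Measurable h)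
    (hhp : MemLp h p μ) {T : ℝ} (hT : 0 ≤ T) : MemLp (X.solBound h T) p μ := by
  have hp0 : p ≠ 0 := (zero_lt_one.trans hp1).ne'
  have hpr : 1 < p.toReal := by
    rw [← ENNReal.toReal_one]
    exact (ENNReal.toReal_lt_toReal ENNReal.one_ne_top hp).2 hp1
  have key : ∀ f : Z → ℝ≥0∞, Measurable f → (∀ z, f z ≤ ‖h z‖ₑ) →
      MemLp (fun z => (X.flow 0 f T z).toReal) p μ := fun f hf hle => by
    refine ⟨(X.measurable_flow_right hf 0 T).ennreal_toReal.aestronglyMeasurable, ?_⟩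
    rw [eLpNorm_lt_top_iff_lintegral_rpow_enorm_lt_top hp0 hp]
    refine lt_of_le_of_lt (lintegral_mono fun z => ENNReal.rpow_le_rpow
      ((Real.enorm_of_nonneg ENNReal.toReal_nonneg).trans_le ENNReal.ofReal_toReal_le)
      ENNReal.toReal_nonneg) (lt_top_iff_ne_top.2 ?_)
    refine X.lintegral_flow_rpow_ne_top hpr hf ?_ hT
    refine ne_top_of_le_ne_top
      (lintegral_rpow_enorm_lt_top_of_eLpNorm_lt_top hp0 hp hhp.2).ne (lintegral_mono fun z => ?_)
    exact ENNReal.rpow_le_rpow (hle z) ENNReal.toReal_nonneg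
  exact (key _ hh.ennreal_ofReal fun z => Real.ofReal_le_enorm _).add
    (key _ (measurable_ofReal_neg hh) fun z => (Real.ofReal_le_enorm _).trans_eq (enorm_neg _))

end JumpProcess

variable {m : ℝ≥0} {b : ℝ → ℝ → ℝ}

/-- The two components of the wave with initial value `c + h` on the loop: `σ = 1` is the
component `ξ` and `σ = -1` is the component `ρ`. -/
noncomputable def Damping.wave (hb : Damping m b) (h : Loop → ℝ) (c σ t x : ℝ) : ℝ :=
  c + hb.process.sol h t ((σ * x - t : ℝ) : Loop)

variable {h : Loop → ℝ}

theorem measurable_coe_loop : Measurable fun x : ℝ => (x : Loop) := AddCircle.measurable_mk'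

theorem Damping.measurable_wave (hb : Damping m b) (hh : Measurable h) (c σ : ℝ) :
    Measurable fun z : ℝ × ℝ => hb.wave h c σ z.1 z.2 := by
  refine Measurable.const_add ((hb.process.measurable_sol hh).comp
    (measurable_fst.prodMk (measurable_coe_loop.comp ?_))) c
  fun_prop

theorem measurePreserving_mul_sub {σ : ℝ} (hσ : σ = 1 ∨ σ = -1) (y : ℝ) :
    MeasurePreserving (fun z : ℝ => σ * z - y) volume volume := by
  rcases hσ with rfl | rfl
  · simpa using measurePreserving_sub_right (volume : Measure ℝ) y
  · simpa [Function.comp_def] using (measurePreserving_sub_right (volume : Measure ℝ) y).comp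
      (Measure.measurePreserving_neg volume)

theorem measurePreserving_const_sub (y : ℝ) :
    MeasurePreserving (fun z : ℝ => y - z) volume volume :=
  Measure.measurePreserving_sub_left volume y

theorem Damping.inBroadSpace_wave (hb : Damping m b) {p : ℝ≥0∞} (hp1 : 1 < p) (hp : p ≠ ∞)
    (hh : Measurable h) (hhp : MemLp h p volume) (c : ℝ) {σ : ℝ} (hσ : σ = 1 ∨ σ = -1) {T : ℝ}
    (hT : 0 < T) : InBroadSpace p T (hb.wave h c σ) := by
  have hσx : ∀ x ∈ Icc (0 : ℝ) 1, σ * x ∈ Icc (-1 : ℝ) 1 := fun x hx => by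
    rcases hσ with rfl | rfl <;> constructor <;> linarith [hx.1, hx.2]
  have hp0 : p ≠ 0 := (zero_lt_one.trans hp1).ne'
  have hi : Integrable h volume := hhp.integrable hp1.le
  set D : Set ℝ := Icc (-(T + 1)) (T + 1) with hD
  set G : ℝ → ℝ := fun z => D.indicator (fun z : ℝ => hb.process.solBound h T (z : Loop)) z with hG
  -- The time is clamped to `[0, T]` so that the bound `solBound h T` holds for all parameters.
  set clamp : ℝ → ℝ := fun t => max 0 (min t T) with hclamp
  have hclamp0 : ∀ t, 0 ≤ clamp t := fun t => le_max_left _ _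
  have hclampT : ∀ t, clamp t ≤ T := fun t => max_le hT.le (min_le_right _ _)
  have hclampe : ∀ t ∈ Icc 0 T, clamp t = t := fun t ht => by simp [hclamp, ht.1, ht.2]
  have hGp : MemLp G p volume := by
    have hmeas : Measurable fun z : ℝ => hb.process.solBound h T (z : Loop) :=
      (hb.process.measurable_solBound hh T).comp measurable_coe_loop
    refine (memLp_indicator_iff_restrict measurableSet_Icc).2 ⟨hmeas.aestronglyMeasurable, ?_⟩
    rw [eLpNorm_lt_top_iff_lintegral_rpow_enorm_lt_top hp0 hp]
    exact lt_top_iff_ne_top.2 (lintegral_Icc_coe_loop_ne_top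
      (φ := fun z => ‖hb.process.solBound h T z‖ₑ ^ p.toReal)
      (lintegral_rpow_enorm_lt_top_of_eLpNorm_lt_top hp0 hp
        (hb.process.memLp_solBound hp1 hp hh hhp hT.le).2).ne _)
  have hgood : ∀ᵐ z : ℝ, (z : Loop) ∈ hb.process.goodSet h :=
    quasiMeasurePreserving_coe_loop.ae (hb.process.ae_mem_goodSet hh hi)
  have key : ∀ e : ℝ → ℝ → ℝ, Measurable (Function.uncurry e) →
      (∀ z, Continuous fun y => e y z) → ∀ (g : ℝ → C(ℝ, ℝ)), Continuous g →
      (∀ y, MeasurePreserving (g y) volume volume) → ∀ I : Set ℝ,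
      ContinuousIntoLp p volume I (fun y z => D.indicator
        (fun w : ℝ => hb.process.sol h (clamp (e y w)) (w : Loop)) (g y z)) := by
    intro e he hec g hg hgm I
    refine continuousIntoLp_comp hp1.le hp
      (F := fun y z => D.indicator (fun w : ℝ => hb.process.sol h (clamp (e y w)) (w : Loop)) z)
      (fun y => ?_) hGp ?_ ?_ g hg hgm I
    · refine (Measurable.indicator ((hb.process.measurable_sol hh).comp
        (Measurable.prodMk ?_ measurable_coe_loop)) measurableSet_Icc).aestronglyMeasurable
      have : Measurable (e y) := he.comp measurable_prodMk_left
      exact measurable_const.max (this.min measurable_const)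
    · filter_upwards [hgood] with z hz y
      by_cases hzD : z ∈ D
      · simp only [hG, indicator_of_mem hzD]
        exact hb.process.abs_sol_le hh hz (hclamp0 _) (hclampT _)
      · simp [hG, indicator_of_notMem hzD]
    · filter_upwards [hgood] with z hz
      by_cases hzD : z ∈ D
      · simp only [indicator_of_mem hzD]
        refine (hb.process.continuous_sol hh hz).comp ?_
        exact continuous_const.max ((hec z).min continuous_const)
      · simp only [indicator_of_notMem hzD]
        exact continuous_const
  refine ⟨(hb.measurable_wave hh c σ).aestronglyMeasurable, ?_, ?_⟩
  · refine ContinuousIntoLp.const_add ?_ c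
    have h1 := key (fun t _ => t) measurable_fst (fun z => continuous_id)
      (fun t => ⟨fun x => σ * x - t, by fun_prop⟩)
      (ContinuousMap.curry ⟨fun y : ℝ × ℝ => σ * y.2 - y.1, by fun_prop⟩).continuous
      (measurePreserving_mul_sub hσ) (Icc 0 T)
    refine h1.restrict_congr measurableSet_Ioo fun t ht x hx => ?_
    have hm : σ * x - t ∈ D := by
      have := hσx x (Ioo_subset_Icc_self hx)
      constructor <;> linarith [this.1, this.2, ht.1, ht.2]
    simp only [ContinuousMap.coe_mk, indicator_of_mem hm, hclampe t ht]
  · refine ContinuousIntoLp.const_add ?_ c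
    have h1 := key (fun x z => σ * x - z) (by fun_prop) (fun z => by fun_prop)
      (fun x => ⟨fun t => σ * x - t, by fun_prop⟩)
      (ContinuousMap.curry ⟨fun y : ℝ × ℝ => σ * y.1 - y.2, by fun_prop⟩).continuous
      (fun x => measurePreserving_const_sub (σ * x)) (Icc 0 1)
    refine h1.restrict_congr measurableSet_Ioo fun x hx t ht => ?_
    have hm : σ * x - t ∈ D := by
      have := hσx x hx
      constructor <;> linarith [this.1, this.2, ht.1, ht.2]
    simp only [ContinuousMap.coe_mk, indicator_of_mem hm, sub_sub_cancel,
      hclampe t (Ioo_subset_Icc_self ht)]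

/-- The wave satisfies its integral equation along the characteristic through `(t, x)`, between
two times at which it runs inside the domain. -/
theorem Damping.wave_eq (hb : Damping m b) (hh : Measurable h) (c : ℝ) {σ : ℝ}
    (hσ : σ = 1 ∨ σ = -1) {s₀ t x : ℝ} (hz : ((σ * x - t : ℝ) : Loop) ∈ hb.process.goodSet h)
    (hs₀ : 0 ≤ s₀) (hst : s₀ ≤ t) (hy : ∀ s ∈ Icc s₀ t, x - σ * (t - s) ∈ Icc (0 : ℝ) 1) :
    hb.wave h c σ t x = hb.wave h c σ s₀ (x - σ * (t - s₀)) + ∫ s in s₀..t,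
      (1 / 2 : ℝ) * b s (x - σ * (t - s)) *
        (hb.wave h c (-σ) s (x - σ * (t - s)) - hb.wave h c σ s (x - σ * (t - s))) := by
  have hσ2 : σ * σ = 1 := by rcases hσ with rfl | rfl <;> norm_num
  have harg : ∀ s, σ * (x - σ * (t - s)) - s = σ * x - t := fun s => by
    linear_combination (s - t) * hσ2
  have hmain := hb.process.sol_sub hh hz hs₀ hst
  have hcongr : ∫ s in s₀..t, (1 / 2 : ℝ) * b s (x - σ * (t - s)) *
        (hb.wave h c (-σ) s (x - σ * (t - s)) - hb.wave h c σ s (x - σ * (t - s))) =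
      ∫ s in s₀..t, (hb.process.jump s ((σ * x - t : ℝ) : Loop)).toReal *
        (hb.process.sol h s (hb.process.refl s ((σ * x - t : ℝ) : Loop)) -
          hb.process.sol h s ((σ * x - t : ℝ) : Loop)) := by
    refine intervalIntegral.integral_congr fun s hs => ?_
    rw [uIcc_of_le hst] at hs
    have hnorm : ‖((σ * x - t : ℝ) : Loop) + (s : Loop)‖ = x - σ * (t - s) := by
      rw [← AddCircle.coe_add, ← norm_coe_of_mem_Icc (hy s hs)]
      rcases hσ with rfl | rfl
      · congr 2
        ring
      · rw [← norm_neg, ← AddCircle.coe_neg]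
        congr 2
        ring
    have hjump : (hb.process.jump s ((σ * x - t : ℝ) : Loop)).toReal =
        (1 / 2 : ℝ) * b s (x - σ * (t - s)) := by
      change (ENNReal.ofReal (b s ‖((σ * x - t : ℝ) : Loop) + (s : Loop)‖ / 2)).toReal = _
      rw [hnorm, ENNReal.toReal_ofReal (by linarith [hb.nonneg s (x - σ * (t - s))])]
      ring
    have hrefl : hb.process.refl s ((σ * x - t : ℝ) : Loop) =
        ((-σ * (x - σ * (t - s)) - s : ℝ) : Loop) := by
      change -((σ * x - t : ℝ) : Loop) - ((2 * s : ℝ) : Loop) = _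
      rw [← AddCircle.coe_neg, ← AddCircle.coe_sub]
      congr 1
      linear_combination (s - t) * hσ2
    simp only [Damping.wave, harg]
    rw [hjump, hrefl]
    ring
  rw [hcongr, ← hmain, Damping.wave, Damping.wave, harg]
  ring

end

/-! ### Existence and decay -/

section

variable {m : ℝ≥0} {b : ℝ → ℝ → ℝ} {h : Loop → ℝ}

/-- The change of variables `(t, x) ↦ (t, σ x - t)` to the label of the characteristic. -/
theorem measurePreserving_label {σ : ℝ} (hσ : σ = 1 ∨ σ = -1) :
    MeasurePreserving (fun z : ℝ × ℝ => (z.1, σ * z.2 - z.1)) volume volume := by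
  rw [Measure.volume_eq_prod]
  exact (MeasurePreserving.id volume).skew_product (g := fun t x => σ * x - t) (by fun_prop)
    (Eventually.of_forall fun t => (measurePreserving_mul_sub hσ t).map_eq)

/-- The inverse change of variables `(s, y) ↦ (s, σ (y + s))`. -/
theorem measurePreserving_char {σ : ℝ} (hσ : σ = 1 ∨ σ = -1) :
    MeasurePreserving (fun z : ℝ × ℝ => (z.1, σ * (z.2 + z.1))) volume volume := by
  rw [Measure.volume_eq_prod]
  refine (MeasurePreserving.id volume).skew_product (g := fun s y => σ * (y + s)) (by fun_prop)
    (Eventually.of_forall fun s => ?_)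
  refine MeasurePreserving.map_eq ?_
  rcases hσ with rfl | rfl
  · simpa using measurePreserving_add_right (volume : Measure ℝ) s
  · simpa [Function.comp_def] using (Measure.measurePreserving_neg volume).comp
      (measurePreserving_add_right (volume : Measure ℝ) s)

theorem quasiMeasurePreserving_label {σ : ℝ} (hσ : σ = 1 ∨ σ = -1) :
    Measure.QuasiMeasurePreserving (fun z : ℝ × ℝ => σ * z.2 - z.1) volume volume := by
  have h1 := (measurePreserving_label hσ).quasiMeasurePreserving
  rw [Measure.volume_eq_prod] at h1
  exact Measure.quasiMeasurePreserving_snd.comp h1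

/-- A property that holds almost everywhere holds almost everywhere on almost every
characteristic. -/
theorem ae_char {σ : ℝ} (hσ : σ = 1 ∨ σ = -1) {Q : ℝ × ℝ → Prop} (hQ : ∀ᵐ q, Q q) :
    ∀ᵐ z : ℝ × ℝ, ∀ᵐ s, Q (s, z.2 - σ * (z.1 - s)) := by
  have hσ2 : σ * σ = 1 := by rcases hσ with rfl | rfl <;> norm_num
  have h1 : ∀ᵐ q : ℝ × ℝ, Q (q.1, σ * (q.2 + q.1)) :=
    (measurePreserving_char hσ).quasiMeasurePreserving.ae hQ
  rw [Measure.volume_eq_prod] at h1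
  have h2 := (Measure.measurePreserving_swap (μ := (volume : Measure ℝ))
    (ν := (volume : Measure ℝ))).quasiMeasurePreserving.ae h1
  have h3 := Measure.ae_ae_of_ae_prod h2
  filter_upwards [(quasiMeasurePreserving_label hσ).ae h3] with z hz
  filter_upwards [hz] with s hs
  have e : z.2 - σ * (z.1 - s) = σ * (σ * z.2 - z.1 + s) := by
    linear_combination (-z.2) * hσ2
  rw [e]
  exact hs

/-- The integral equation of the wave with a damping coefficient that agrees with `b` on the
characteristic. -/
theorem Damping.wave_eq_of_ae (hb : Damping m b) (hh : Measurable h) (c : ℝ) {σ : ℝ}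
    (hσ : σ = 1 ∨ σ = -1) {s₀ t x : ℝ} (hz : ((σ * x - t : ℝ) : Loop) ∈ hb.process.goodSet h)
    (hs₀ : 0 ≤ s₀) (hst : s₀ ≤ t) (hy : ∀ s ∈ Icc s₀ t, x - σ * (t - s) ∈ Icc (0 : ℝ) 1)
    {a : ℝ → ℝ → ℝ}
    (hab : ∀ᵐ s, s ∈ Ioc s₀ t → a s (x - σ * (t - s)) = b s (x - σ * (t - s))) :
    hb.wave h c σ t x = hb.wave h c σ s₀ (x - σ * (t - s₀)) + ∫ s in s₀..t,
      (1 / 2 : ℝ) * a s (x - σ * (t - s)) *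
        (hb.wave h c (-σ) s (x - σ * (t - s)) - hb.wave h c σ s (x - σ * (t - s))) := by
  rw [hb.wave_eq hh c hσ hz hs₀ hst hy]
  congr 1
  refine intervalIntegral.integral_congr_ae ?_
  filter_upwards [hab] with s hs hm
  rw [uIoc_of_le hst] at hm
  rw [hs hm]

theorem Damping.isBroadSolutionOn_wave (hb : Damping m b) {p : ℝ≥0∞} (hp1 : 1 < p) (hp : p ≠ ∞)
    (hh : Measurable h) (hhp : MemLp h p volume) (c : ℝ) {a : ℝ → ℝ → ℝ}
    (hab : ∀ᵐ z : ℝ × ℝ ∂(volume.restrict (Ioi (0 : ℝ) ×ˢ Ioo (0 : ℝ) 1)), a z.1 z.2 = b z.1 z.2)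
    {ρ₀ ξ₀ : ℝ → ℝ}
    (hρ : ∀ᵐ x : ℝ ∂(volume.restrict (Ioo (0 : ℝ) 1)), c + h ((-x : ℝ) : Loop) = ρ₀ x)
    (hξ : ∀ᵐ x : ℝ ∂(volume.restrict (Ioo (0 : ℝ) 1)), c + h (x : Loop) = ξ₀ x) :
    IsBroadSolution p a ρ₀ ξ₀ (hb.wave h c (-1)) (hb.wave h c 1) := by
  intro T hT
  have hi : Integrable h volume := hhp.integrable hp1.le
  have hD : MeasurableSet (Ioi (0 : ℝ) ×ˢ Ioo (0 : ℝ) 1) := measurableSet_Ioi.prod measurableSet_Ioo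
  have hDT : MeasurableSet (Ioo (0 : ℝ) T ×ˢ Ioo (0 : ℝ) 1) :=
    measurableSet_Ioo.prod measurableSet_Ioo
  have hab' := (ae_restrict_iff' hD).1 hab
  have hgood : ∀ {σ : ℝ}, σ = 1 ∨ σ = -1 →
      ∀ᵐ z : ℝ × ℝ, ((σ * z.2 - z.1 : ℝ) : Loop) ∈ hb.process.goodSet h := fun hσ =>
    (quasiMeasurePreserving_coe_loop.comp (quasiMeasurePreserving_label hσ)).ae
      (hb.process.ae_mem_goodSet hh hi)
  refine ⟨hb.inBroadSpace_wave hp1 hp hh hhp c (Or.inr rfl) hT,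
    hb.inBroadSpace_wave hp1 hp hh hhp c (Or.inl rfl) hT, ?_, ?_, ?_, ?_, ?_, ?_⟩
  · rw [ae_restrict_iff' hDT]
    filter_upwards [hgood (Or.inr rfl), ae_char (σ := -1) (Or.inr rfl) hab'] with z hz ha hzD
    obtain ⟨⟨ht0, -⟩, ⟨hx0, hx1⟩⟩ := hzD
    set s₀ := max 0 (z.1 + z.2 - 1) with hs₀
    have h0 : 0 ≤ s₀ := le_max_left _ _
    have h1 : z.1 + z.2 - 1 ≤ s₀ := le_max_right _ _
    have h2 : s₀ ≤ z.1 := max_le ht0.le (by linarith)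
    have key := hb.wave_eq_of_ae hh c (Or.inr rfl) hz h0 h2
      (fun s hs => ⟨by linarith [hs.2], by linarith [hs.1]⟩) (a := a) (by
        filter_upwards [ha] with s hs hm
        exact hs ⟨h0.trans_lt hm.1, by simp only; linarith [hm.2],
          by simp only; linarith [hm.1]⟩)
    have e : ∀ s, z.2 - -1 * (z.1 - s) = z.2 + z.1 - s := fun s => by ring
    simp only [e, neg_neg] at key
    rw [key]
    congr 1
    refine intervalIntegral.integral_congr fun s _ => ?_
    ring
  · rw [ae_restrict_iff' hDT]
    filter_upwards [hgood (Or.inl rfl), ae_char (σ := 1) (Or.inl rfl) hab'] with z hz ha hzD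
    obtain ⟨⟨ht0, -⟩, ⟨hx0, hx1⟩⟩ := hzD
    set s₀ := max 0 (z.1 - z.2) with hs₀
    have h0 : 0 ≤ s₀ := le_max_left _ _
    have h1 : z.1 - z.2 ≤ s₀ := le_max_right _ _
    have h2 : s₀ ≤ z.1 := max_le ht0.le (by linarith)
    have h3 : ∀ s, s₀ < s → 0 < z.2 - (z.1 - s) := fun s hs => by linarith
    have key := hb.wave_eq_of_ae hh c (Or.inl rfl) hz h0 h2
      (fun s hs => ⟨by linarith [hs.1], by linarith [hs.2]⟩) (a := a) (by
        filter_upwards [ha] with s hs hm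
        exact hs ⟨h0.trans_lt hm.1, by simp only; linarith [hm.1],
          by simp only; linarith [hm.2]⟩)
    have e : ∀ s, z.2 - 1 * (z.1 - s) = z.2 - z.1 + s := fun s => by ring
    simp only [e] at key
    exact key
  · refine ae_of_all _ fun t => ?_
    simp [Damping.wave]
  · refine ae_of_all _ fun t => ?_
    have e : ((-1 * 1 - t : ℝ) : Loop) = ((1 * 1 - t : ℝ) : Loop) := by
      rw [← AddCircle.coe_add_period 2 (-1 * 1 - t)]
      congr 1
      ring
    simp only [Damping.wave, e, sub_self]
  · filter_upwards [hρ] with x hx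
    rw [← hx, Damping.wave, hb.process.sol_zero hh]
    simp
  · filter_upwards [hξ] with x hx
    rw [← hx, Damping.wave, hb.process.sol_zero hh]
    simp

/-- The initial value on the loop, measurable, that corresponds to `(ρ₀ - c, ξ₀ - c)`. -/
theorem exists_loop_data {p : ℝ≥0∞} (hp0 : p ≠ 0) (hp : p ≠ ∞) {ρ₀ ξ₀ : ℝ → ℝ}
    (hρ : MemLp ρ₀ p (volume.restrict (Ioo (0 : ℝ) 1)))
    (hξ : MemLp ξ₀ p (volume.restrict (Ioo (0 : ℝ) 1))) (c : ℝ) :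
    ∃ h : Loop → ℝ, Measurable h ∧ MemLp h p volume ∧
      (∀ᵐ x : ℝ ∂(volume.restrict (Ioo (0 : ℝ) 1)), c + h ((-x : ℝ) : Loop) = ρ₀ x) ∧
      (∀ᵐ x : ℝ ∂(volume.restrict (Ioo (0 : ℝ) 1)), c + h (x : Loop) = ξ₀ x) := by
  set r : Loop → ℝ := fun z => AddCircle.measurableEquivIoc 2 (-1) z with hr
  have hrm : Measurable r :=
    measurable_subtype_coe.comp (AddCircle.measurableEquivIoc 2 (-1)).measurable
  have hrx : ∀ x ∈ Ioc (-1 : ℝ) 1, r (x : Loop) = x := fun x hx => by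
    have : x ∈ Ioc (-1 : ℝ) (-1 + 2) := by norm_num; exact hx
    exact congrArg Subtype.val (AddCircle.equivIoc_coe_eq this)
  set ρ' := hρ.aestronglyMeasurable.mk ρ₀
  set ξ' := hξ.aestronglyMeasurable.mk ξ₀
  have hρ' : Measurable ρ' := hρ.aestronglyMeasurable.stronglyMeasurable_mk.measurable
  have hξ' : Measurable ξ' := hξ.aestronglyMeasurable.stronglyMeasurable_mk.measurable
  set h : Loop → ℝ := fun z => if 0 < r z then ξ' (r z) - c else ρ' (-r z) - c with hh
  have hhm : Measurable h := Measurable.ite (measurableSet_lt measurable_const hrm)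
    ((hξ'.comp hrm).sub_const c) ((hρ'.comp hrm.neg).sub_const c)
  have h1 : ∀ x ∈ Ioo (0 : ℝ) 1, h ((-x : ℝ) : Loop) = ρ' x - c := fun x hx => by
    simp only [hh]
    rw [hrx (-x) ⟨by linarith [hx.2], by linarith [hx.1]⟩, if_neg (by linarith [hx.1]), neg_neg]
  have h2 : ∀ x ∈ Ioo (0 : ℝ) 1, h (x : Loop) = ξ' x - c := fun x hx => by
    simp only [hh]
    rw [hrx x ⟨by linarith [hx.1], hx.2.le⟩, if_pos hx.1]
  have hae1 : ∀ᵐ x : ℝ ∂(volume.restrict (Ioo (0 : ℝ) 1)), c + h ((-x : ℝ) : Loop) = ρ₀ x := by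
    filter_upwards [hρ.aestronglyMeasurable.ae_eq_mk, ae_restrict_mem measurableSet_Ioo]
      with x hx hm
    rw [h1 x hm, hx]
    ring
  have hae2 : ∀ᵐ x : ℝ ∂(volume.restrict (Ioo (0 : ℝ) 1)), c + h (x : Loop) = ξ₀ x := by
    filter_upwards [hξ.aestronglyMeasurable.ae_eq_mk, ae_restrict_mem measurableSet_Ioo]
      with x hx hm
    rw [h2 x hm, hx]
    ring
  refine ⟨h, hhm, ⟨hhm.aestronglyMeasurable, ?_⟩, hae1, hae2⟩
  have hφ : Measurable fun z => ‖h z‖ₑ ^ p.toReal := hhm.enorm.pow_const _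
  rw [eLpNorm_lt_top_iff_lintegral_rpow_enorm_lt_top hp0 hp, lintegral_loop hφ,
    lintegral_add_right (g := fun x : ℝ => ‖h x‖ₑ ^ p.toReal) _ (hφ.comp measurable_coe_loop),
    ENNReal.add_lt_top]
  constructor
  · have := lintegral_rpow_enorm_lt_top_of_eLpNorm_lt_top hp0 hp (hρ.sub (memLp_const c)).2
    refine (lintegral_congr_ae ?_).trans_lt this
    filter_upwards [hae1] with x hx
    simp [← hx]
  · have := lintegral_rpow_enorm_lt_top_of_eLpNorm_lt_top hp0 hp (hξ.sub (memLp_const c)).2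
    refine (lintegral_congr_ae ?_).trans_lt this
    filter_upwards [hae2] with x hx
    simp [← hx]

theorem integral_loop (hi : Integrable h volume) :
    ∫ z, h z = ∫ x in (0 : ℝ)..1, (h ((-x : ℝ) : Loop) + h (x : Loop)) := by
  have hint : IntervalIntegrable (fun x : ℝ => h (x : Loop)) volume (-1) 1 := by
    rw [intervalIntegrable_iff_integrableOn_Ioc_of_le (by norm_num)]
    have := (AddCircle.measurePreserving_mk 2 (-1)).integrable_comp_of_integrable hi
    norm_num at this
    exact this
  have h1 : IntervalIntegrable (fun x : ℝ => h (x : Loop)) volume (-1) 0 :=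
    hint.mono_set (by
      rw [uIcc_of_le, uIcc_of_le] <;> norm_num
      exact Icc_subset_Icc_right zero_le_one)
  have h2 : IntervalIntegrable (fun x : ℝ => h (x : Loop)) volume 0 1 :=
    hint.mono_set (by
      rw [uIcc_of_le, uIcc_of_le] <;> norm_num
      exact Icc_subset_Icc_left (by norm_num))
  have h3 : IntervalIntegrable (fun x : ℝ => h ((-x : ℝ) : Loop)) volume 0 1 := by
    have := IntervalIntegrable.comp_sub_left h1 0
    simpa using this.symm
  have h4 := AddCircle.intervalIntegral_preimage 2 (-1) h
  rw [← h4, intervalIntegral.integral_add h3 h2,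
    intervalIntegral.integral_comp_neg fun x : ℝ => h (x : Loop),
    show (-1 : ℝ) + 2 = 1 by norm_num, neg_zero,
    intervalIntegral.integral_add_adjacent_intervals h1 h2]

/-- The initial value on the loop has mean zero if `c` is the mean value of the data, so that its
positive and negative parts have the same mass. -/
theorem lintegral_pos_eq_lintegral_neg (hi : Integrable h volume) {ρ₀ ξ₀ : ℝ → ℝ}
    (hρi : IntervalIntegrable ρ₀ volume 0 1) (hξi : IntervalIntegrable ξ₀ volume 0 1)
    (hρ : ∀ᵐ x : ℝ ∂(volume.restrict (Ioo (0 : ℝ) 1)), meanValue ρ₀ ξ₀ + h ((-x : ℝ) : Loop) = ρ₀ x)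
    (hξ : ∀ᵐ x : ℝ ∂(volume.restrict (Ioo (0 : ℝ) 1)), meanValue ρ₀ ξ₀ + h (x : Loop) = ξ₀ x) :
    ∫⁻ z, ENNReal.ofReal (h z) = ∫⁻ z, ENNReal.ofReal (-h z) := by
  have h0 : ∫ z, h z = 0 := by
    set c := meanValue ρ₀ ξ₀ with hc
    have e : ∫ x in (0 : ℝ)..1, (h ((-x : ℝ) : Loop) + h (x : Loop)) =
        ∫ x in (0 : ℝ)..1, ((ρ₀ x + ξ₀ x) - 2 * c) := by
      rw [intervalIntegral.integral_of_le zero_le_one, intervalIntegral.integral_of_le zero_le_one,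
        ← restrict_Ioo_eq_restrict_Ioc]
      refine integral_congr_ae ?_
      filter_upwards [hρ, hξ] with x h1 h2
      rw [← h1, ← h2]
      ring
    rw [integral_loop hi, e, intervalIntegral.integral_sub (hρi.add hξi)
      (by simp), intervalIntegral.integral_const, hc, meanValue]
    simp
  rw [integral_eq_lintegral_pos_part_sub_lintegral_neg_part hi, sub_eq_zero] at h0
  exact (ENNReal.toReal_eq_toReal_iff' hi.lintegral_lt_top.ne hi.neg.lintegral_lt_top.ne).1 h0

theorem lintegral_loop_eq_pairLpNorm_rpow (p : ℝ≥0∞) (hh : Measurable h) :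
    (∫⁻ z, ‖h z‖ₑ ^ p.toReal) ^ (1 / p.toReal) =
      pairLpNorm p (fun x => h ((-x : ℝ) : Loop)) (fun x => h (x : Loop)) := by
  rw [pairLpNorm, lintegral_loop (hh.enorm.pow_const _)]

/-- Exponential decay of the wave, in the form of a geometric decay over time steps. -/
theorem Damping.pairLpNorm_wave_le (hb : Damping m b) {p : ℝ≥0∞} (hp1 : 1 < p) (hp : p ≠ ∞)
    (hh : Measurable h) (hhp : MemLp h p volume) (c : ℝ)
    (h0 : ∫⁻ z, ENNReal.ofReal (h z) = ∫⁻ z, ENNReal.ofReal (-h z)) {κ : ℝ≥0} {τ : ℝ}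
    (hτ : 0 ≤ τ) (hκ : ∀ t₀, 0 ≤ t₀ → ∀ z, κ • volume ≤ hb.process.kernel t₀ (t₀ + τ) z)
    (n : ℕ) {t : ℝ} (ht : n * τ ≤ t) :
    pairLpNorm p (fun x => hb.wave h c (-1) t x - c) (fun x => hb.wave h c 1 t x - c) ≤
      (1 - 2 * κ) ^ n *
        pairLpNorm p (fun x => h ((-x : ℝ) : Loop)) (fun x => h (x : Loop)) := by
  have hp0 : p ≠ 0 := (zero_lt_one.trans hp1).ne'
  have hpr : 1 < p.toReal := by
    rw [← ENNReal.toReal_one]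
    exact (ENNReal.toReal_lt_toReal ENNReal.one_ne_top hp).2 hp1
  have hpr0 : 0 < p.toReal := zero_lt_one.trans hpr
  have hi : Integrable h volume := hhp.integrable hp1.le
  have hsol : Measurable (hb.process.sol h t) :=
    hb.process.measurable_sol_right hh t
  have e1 : pairLpNorm p (fun x => hb.wave h c (-1) t x - c) (fun x => hb.wave h c 1 t x - c) =
      (∫⁻ z, ‖hb.process.sol h t z‖ₑ ^ p.toReal) ^ (1 / p.toReal) := by
    rw [← lintegral_sub_right_eq_self _ ((t : ℝ) : Loop)]
    rw [lintegral_loop_eq_pairLpNorm_rpow p (h := fun z => hb.process.sol h t (z - (t : Loop)))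
      (hsol.comp (measurable_id.sub_const _))]
    congr 1 <;> ext x <;> simp [Damping.wave]
  have hgap : ∀ z, gap (ENNReal.ofReal (h z)) (ENNReal.ofReal (-h z)) = ‖h z‖ₑ := fun z =>
    gap_ofReal_ofReal_neg _
  have hmain := hb.process.lintegral_gap_evol_le_pow hpr hτ hκ hh.ennreal_ofReal
    (JumpProcess.measurable_ofReal_neg hh) h0 hi.lintegral_lt_top.ne (by
      simp_rw [hgap]
      exact (lintegral_rpow_enorm_lt_top_of_eLpNorm_lt_top hp0 hp hhp.2).ne) n ht
  simp_rw [hgap] at hmain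
  have hvol : (1 : ℝ≥0∞) - κ * volume (univ : Set Loop) = 1 - 2 * κ := by
    rw [AddCircle.measure_univ, ENNReal.ofReal_ofNat, mul_comm]
  rw [hvol] at hmain
  rw [e1, ← lintegral_loop_eq_pairLpNorm_rpow p hh]
  calc (∫⁻ z, ‖hb.process.sol h t z‖ₑ ^ p.toReal) ^ (1 / p.toReal)
      ≤ (((1 - 2 * κ) ^ p.toReal) ^ n * ∫⁻ z, ‖h z‖ₑ ^ p.toReal) ^ (1 / p.toReal) := by
        refine ENNReal.rpow_le_rpow (le_trans (lintegral_mono fun z => ?_) hmain) (by positivity)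
        exact ENNReal.rpow_le_rpow (enorm_toReal_sub_toReal_le_gap _ _) hpr0.le
    _ = _ := by
        rw [ENNReal.mul_rpow_of_nonneg _ _ (by positivity), ← ENNReal.rpow_natCast,
          ← ENNReal.rpow_natCast, ← ENNReal.rpow_mul, ← ENNReal.rpow_mul]
        congr 2
        field_simp

end

/-! ### Continuity of weighted norms, and differences of solutions -/

section

theorem ContinuousIntoLp.sub {p : ℝ≥0∞} (hp : 1 ≤ p) {μ : Measure ℝ} {I : Set ℝ}
    {u v : ℝ → ℝ → ℝ} (hu : ContinuousIntoLp p μ I u) (hv : ContinuousIntoLp p μ I v) :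
    ContinuousIntoLp p μ I (fun y z => u y z - v y z) := by
  refine ⟨fun y hy => (hu.1 y hy).sub (hv.1 y hy), fun y₀ hy₀ => ?_⟩
  have h := (hu.2 y₀ hy₀).add (hv.2 y₀ hy₀)
  rw [add_zero] at h
  refine tendsto_of_tendsto_of_tendsto_of_le_of_le' tendsto_const_nhds h
    (Eventually.of_forall fun _ => bot_le) ?_
  filter_upwards [self_mem_nhdsWithin] with y hy
  refine le_trans (le_of_eq ?_) (eLpNorm_sub_le
    ((hu.1 y hy).1.sub (hu.1 y₀ hy₀).1) ((hv.1 y hy).1.sub (hv.1 y₀ hy₀).1) hp)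
  congr 1
  ext z
  simp only [Pi.sub_apply]
  ring

/-- Weighted `L¹` norms, with a weight at most `1`, are continuous along a continuous map into
`L^p`. -/
theorem ContinuousIntoLp.continuousOn_lintegral {p : ℝ≥0∞} (hp : 1 ≤ p) {μ : Measure ℝ}
    [IsFiniteMeasure μ] {I : Set ℝ} {u : ℝ → ℝ → ℝ} (hu : ContinuousIntoLp p μ I u)
    {w : ℝ → ℝ≥0∞} (hw1 : ∀ᵐ z ∂μ, w z ≤ 1) :
    ContinuousOn (fun y => ∫⁻ z, w z * ‖u y z‖ₑ ∂μ) I ∧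
      ∀ y ∈ I, ∫⁻ z, w z * ‖u y z‖ₑ ∂μ ≠ ∞ := by
  have hle : ∀ f : ℝ → ℝ, ∫⁻ z, w z * ‖f z‖ₑ ∂μ ≤ ∫⁻ z, ‖f z‖ₑ ∂μ := fun f => by
    refine lintegral_mono_ae ?_
    filter_upwards [hw1] with z hz
    exact mul_le_of_le_one_left bot_le hz
  have hfin : ∀ y ∈ I, ∫⁻ z, w z * ‖u y z‖ₑ ∂μ ≠ ∞ := fun y hy =>
    ne_top_of_le_ne_top ((hu.1 y hy).integrable hp).2.ne (hle _)
  refine ⟨fun y₀ hy₀ => ?_, hfin⟩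
  set d : ℝ → ℝ≥0∞ := fun y => eLpNorm (fun z => u y z - u y₀ z) p μ *
    μ univ ^ (1 / (1 : ℝ≥0∞).toReal - 1 / p.toReal) with hd
  have hd0 : Tendsto d (𝓝[I] y₀) (𝓝 0) := by
    have hC : μ univ ^ (1 / (1 : ℝ≥0∞).toReal - 1 / p.toReal) ≠ ∞ := by
      refine ENNReal.rpow_ne_top_of_nonneg ?_ (measure_ne_top _ _)
      rcases eq_or_ne p ∞ with rfl | h
      · simp
      · have : 1 ≤ p.toReal := by
          rw [← ENNReal.toReal_one]
          exact ENNReal.toReal_mono h hp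
        rw [ENNReal.toReal_one, sub_nonneg]
        exact one_div_le_one_div_of_le one_pos this
    rw [hd]
    simpa using ENNReal.Tendsto.mul_const (hu.2 y₀ hy₀) (Or.inr hC)
  have hdiff : ∀ y ∈ I, ∫⁻ z, ‖u y z - u y₀ z‖ₑ ∂μ ≤ d y := fun y hy => by
    rw [← eLpNorm_one_eq_lintegral_enorm]
    exact eLpNorm_le_eLpNorm_mul_rpow_measure_univ hp ((hu.1 y hy).sub (hu.1 y₀ hy₀)).1
  have hadd : ∀ y₁ ∈ I, ∀ y₂ ∈ I, ∫⁻ z, w z * ‖u y₁ z‖ₑ ∂μ ≤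
      ∫⁻ z, w z * ‖u y₂ z‖ₑ ∂μ + ∫⁻ z, ‖u y₁ z - u y₂ z‖ₑ ∂μ := fun y₁ h₁ y₂ h₂ => by
    rw [← lintegral_add_right' (g := fun z => ‖u y₁ z - u y₂ z‖ₑ) _
      ((hu.1 y₁ h₁).sub (hu.1 y₂ h₂)).1.enorm]
    refine lintegral_mono_ae ?_
    filter_upwards [hw1] with z hz
    calc w z * ‖u y₁ z‖ₑ ≤ w z * (‖u y₂ z‖ₑ + ‖u y₁ z - u y₂ z‖ₑ) := by
          gcongr
          calc ‖u y₁ z‖ₑ = ‖u y₂ z + (u y₁ z - u y₂ z)‖ₑ := by rw [add_sub_cancel]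
            _ ≤ _ := enorm_add_le _ _
      _ ≤ _ := by
          rw [mul_add]
          gcongr
          exact mul_le_of_le_one_left bot_le hz
  refine (ENNReal.tendsto_nhds (hfin y₀ hy₀)).2 fun ε hε => ?_
  filter_upwards [self_mem_nhdsWithin, hd0.eventually (gt_mem_nhds hε)] with y hy hdy
  constructor
  · rw [tsub_le_iff_right]
    refine (hadd y₀ hy₀ y hy).trans (add_le_add le_rfl ?_)
    simp_rw [← enorm_neg (u y₀ _ - u y _), neg_sub]
    exact (hdiff y hy).trans hdy.le
  · exact (hadd y hy y₀ hy₀).trans (add_le_add le_rfl ((hdiff y hy).trans hdy.le))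

theorem le_of_ae_le_of_continuousOn {f g : ℝ → ℝ≥0∞} {a b : ℝ} (hab : a < b)
    (hf : ContinuousOn f (Icc a b)) (hg : ContinuousOn g (Icc a b))
    (h : ∀ᵐ x ∂(volume.restrict (Ioo a b)), f x ≤ g x) : ∀ x ∈ Icc a b, f x ≤ g x := by
  have h1 : (fun x => max (f x) (g x)) =ᵐ[volume.restrict (Icc a b)] g := by
    rw [restrict_Ioo_eq_restrict_Ioc, restrict_Ioc_eq_restrict_Icc] at h
    filter_upwards [h] with x hx
    exact max_eq_right hx
  have h2 := Measure.eqOn_Icc_of_ae_eq volume hab.ne h1 (hf.sup hg) hg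
  exact fun x hx => max_eq_right_iff.1 (h2 hx)

variable {p : ℝ≥0∞} {T : ℝ}

theorem InBroadSpace.sub (hp : 1 ≤ p) {u v : ℝ → ℝ → ℝ} (hu : InBroadSpace p T u)
    (hv : InBroadSpace p T v) : InBroadSpace p T (fun t x => u t x - v t x) :=
  ⟨hu.1.sub hv.1, hu.2.sub hp hv.2, hu.3.sub hp hv.3⟩

theorem InBroadSpace.integrable (hp : 1 ≤ p) (hT : 0 < T) {u : ℝ → ℝ → ℝ}
    (hu : InBroadSpace p T u) : Integrable (fun z : ℝ × ℝ => u z.1 z.2)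
      (volume.restrict (Ioo (0 : ℝ) T ×ˢ Ioo (0 : ℝ) 1)) := by
  refine ⟨hu.1, ?_⟩
  obtain ⟨hc, hfin⟩ := hu.2.continuousOn_lintegral hp (w := fun _ => 1)
    (ae_of_all _ fun _ => le_rfl)
  simp only [one_mul] at hc hfin
  obtain ⟨t₀, ht₀, hmax⟩ := isCompact_Icc.exists_isMaxOn ⟨0, left_mem_Icc.2 hT.le⟩ hc
  have hm : AEMeasurable (fun z : ℝ × ℝ => ‖u z.1 z.2‖ₑ)
      ((volume.restrict (Ioo (0 : ℝ) T)).prod (volume.restrict (Ioo (0 : ℝ) 1))) := by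
    rw [Measure.prod_restrict]
    exact hu.1.enorm
  rw [HasFiniteIntegral, Measure.volume_eq_prod, ← Measure.prod_restrict, lintegral_prod _ hm]
  refine lt_of_le_of_lt (setLIntegral_mono' measurableSet_Ioo fun t ht =>
    hmax (Ioo_subset_Icc_self ht)) ?_
  rw [setLIntegral_const]
  exact ENNReal.mul_lt_top (hfin t₀ ht₀).lt_top (by simp)

/-- A function that is integrable on the plane is integrable on almost every characteristic. -/
theorem ae_integrable_char {σ : ℝ} (hσ : σ = 1 ∨ σ = -1) {φ : ℝ × ℝ → ℝ}
    (hφ : Integrable φ volume) :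
    ∀ᵐ z : ℝ × ℝ, Integrable (fun s => φ (s, z.2 - σ * (z.1 - s))) volume := by
  have hσ2 : σ * σ = 1 := by rcases hσ with rfl | rfl <;> norm_num
  have h1 := (measurePreserving_char hσ).integrable_comp_of_integrable hφ
  rw [Measure.volume_eq_prod] at h1
  filter_upwards [(quasiMeasurePreserving_label hσ).ae h1.prod_left_ae] with z hz
  refine hz.congr (ae_of_all _ fun s => ?_)
  simp only [Function.comp]
  congr 2
  linear_combination z.2 * hσ2

/-- The coefficient `a` is measurable and bounded by `M` almost everywhere in `(0, T) × (0, 1)`. -/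
structure IsBoundedDamping (M : ℝ≥0) (T : ℝ) (a : ℝ → ℝ → ℝ) : Prop where
  aestronglyMeasurable : AEStronglyMeasurable (fun z : ℝ × ℝ => a z.1 z.2)
    (volume.restrict (Ioo (0 : ℝ) T ×ˢ Ioo (0 : ℝ) 1))
  enorm_le : ∀ᵐ z : ℝ × ℝ ∂(volume.restrict (Ioo (0 : ℝ) T ×ˢ Ioo (0 : ℝ) 1)),
    ‖a z.1 z.2‖ₑ ≤ M

variable {M : ℝ≥0} {a : ℝ → ℝ → ℝ}

theorem IsBoundedDamping.integrable_mul (ha : IsBoundedDamping M T a) {v : ℝ → ℝ → ℝ}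
    (hv : Integrable (fun z : ℝ × ℝ => v z.1 z.2)
      (volume.restrict (Ioo (0 : ℝ) T ×ˢ Ioo (0 : ℝ) 1))) :
    Integrable (fun z : ℝ × ℝ => a z.1 z.2 * v z.1 z.2)
      (volume.restrict (Ioo (0 : ℝ) T ×ˢ Ioo (0 : ℝ) 1)) := by
  refine hv.bdd_mul (c := M) ha.1 ?_
  filter_upwards [ha.2] with z hz
  exact enorm_le_coe.1 hz

theorem ae_intervalIntegrable_char {σ : ℝ} (hσ : σ = 1 ∨ σ = -1) {φ : ℝ × ℝ → ℝ}
    (hφ : Integrable φ (volume.restrict (Ioo (0 : ℝ) T ×ˢ Ioo (0 : ℝ) 1))) :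
    ∀ᵐ z : ℝ × ℝ, ∀ s₀, s₀ ≤ z.1 → (∀ s ∈ Ioc s₀ z.1,
      (s, z.2 - σ * (z.1 - s)) ∈ Ioo (0 : ℝ) T ×ˢ Ioo (0 : ℝ) 1) →
      IntervalIntegrable (fun s => φ (s, z.2 - σ * (z.1 - s))) volume s₀ z.1 := by
  have hD : MeasurableSet (Ioo (0 : ℝ) T ×ˢ Ioo (0 : ℝ) 1) :=
    measurableSet_Ioo.prod measurableSet_Ioo
  filter_upwards [ae_integrable_char hσ ((integrable_indicator_iff hD).2 hφ)] with z hz s₀ hs₀ hin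
  rw [intervalIntegrable_iff_integrableOn_Ioc_of_le hs₀]
  refine hz.integrableOn.congr_fun (fun s hs => ?_) measurableSet_Ioc
  exact indicator_of_mem (hin s hs) _

/-- The difference of two broad solutions is a broad solution with initial value zero. -/
theorem IsBroadSolutionOn.sub (hp : 1 ≤ p) (hT : 0 < T) (ha : IsBoundedDamping M T a)
    {ρ₀ ξ₀ : ℝ → ℝ} {ρ ξ ρ' ξ' : ℝ → ℝ → ℝ} (h : IsBroadSolutionOn p a ρ₀ ξ₀ T ρ ξ)
    (h' : IsBroadSolutionOn p a ρ₀ ξ₀ T ρ' ξ') :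
    IsBroadSolutionOn p a 0 0 T (fun t x => ρ t x - ρ' t x) (fun t x => ξ t x - ξ' t x) := by
  have hD : MeasurableSet (Ioo (0 : ℝ) T ×ˢ Ioo (0 : ℝ) 1) :=
    measurableSet_Ioo.prod measurableSet_Ioo
  have hi := ha.integrable_mul (v := fun t x => ρ t x - ξ t x)
    ((h.1.sub hp h.2).integrable hp hT)
  have hi' := ha.integrable_mul (v := fun t x => ρ' t x - ξ' t x)
    ((h'.1.sub hp h'.2).integrable hp hT)
  refine ⟨h.1.sub hp h'.1, h.2.sub hp h'.2, ?_, ?_, ?_, ?_, ?_, ?_⟩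
  · filter_upwards [h.3, h'.3, ae_restrict_of_ae (ae_intervalIntegrable_char (Or.inr rfl) hi),
      ae_restrict_of_ae (ae_intervalIntegrable_char (Or.inr rfl) hi'), ae_restrict_mem hD]
      with z e e' i i' hz
    obtain ⟨⟨ht0, htT⟩, ⟨hx0, hx1⟩⟩ := hz
    set s₀ := max 0 (z.1 + z.2 - 1) with hs₀
    have h0 : 0 ≤ s₀ := le_max_left _ _
    have h1 : z.1 + z.2 - 1 ≤ s₀ := le_max_right _ _
    have h2 : s₀ ≤ z.1 := max_le ht0.le (by linarith)
    have hin : ∀ s ∈ Ioc s₀ z.1, (s, z.2 - -1 * (z.1 - s)) ∈ Ioo (0 : ℝ) T ×ˢ Ioo (0 : ℝ) 1 :=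
      fun s hs => ⟨⟨h0.trans_lt hs.1, hs.2.trans_lt htT⟩, ⟨by simp only; linarith [hs.2],
        by simp only; linarith [hs.1]⟩⟩
    have j := (i s₀ h2 hin).const_mul (-(1 / 2))
    have j' := (i' s₀ h2 hin).const_mul (-(1 / 2))
    have ec : ∀ s, z.2 - -1 * (z.1 - s) = z.2 + z.1 - s := fun s => by ring
    simp only [ec, ← mul_assoc] at j j'
    rw [e, e', add_sub_add_comm, ← intervalIntegral.integral_sub j j']
    congr 1
    refine intervalIntegral.integral_congr fun s _ => ?_
    ring
  · filter_upwards [h.4, h'.4, ae_restrict_of_ae (ae_intervalIntegrable_char (Or.inl rfl) hi),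
      ae_restrict_of_ae (ae_intervalIntegrable_char (Or.inl rfl) hi'), ae_restrict_mem hD]
      with z e e' i i' hz
    obtain ⟨⟨ht0, htT⟩, ⟨hx0, hx1⟩⟩ := hz
    set s₀ := max 0 (z.1 - z.2) with hs₀
    have h0 : 0 ≤ s₀ := le_max_left _ _
    have h1 : z.1 - z.2 ≤ s₀ := le_max_right _ _
    have h2 : s₀ ≤ z.1 := max_le ht0.le (by linarith)
    have hin : ∀ s ∈ Ioc s₀ z.1, (s, z.2 - 1 * (z.1 - s)) ∈ Ioo (0 : ℝ) T ×ˢ Ioo (0 : ℝ) 1 :=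
      fun s hs => ⟨⟨h0.trans_lt hs.1, hs.2.trans_lt htT⟩, ⟨by simp only; linarith [hs.1],
        by simp only; linarith [hs.2]⟩⟩
    have j := (i s₀ h2 hin).const_mul (1 / 2)
    have j' := (i' s₀ h2 hin).const_mul (1 / 2)
    have ec : ∀ s, z.2 - 1 * (z.1 - s) = z.2 - z.1 + s := fun s => by ring
    simp only [ec, ← mul_assoc] at j j'
    rw [e, e', add_sub_add_comm, ← intervalIntegral.integral_sub j j']
    congr 1
    refine intervalIntegral.integral_congr fun s _ => ?_
    ring
  · filter_upwards [h.5, h'.5] with t e e'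
    linarith
  · filter_upwards [h.6, h'.6] with t e e'
    linarith
  · filter_upwards [h.7, h'.7] with x e e'
    simp [e, e']
  · filter_upwards [h.8, h'.8] with x e e'
    simp [e, e']

end

/-! ### Uniqueness -/

section

theorem lintegral_exp_neg_le {k x : ℝ} (hk : 0 < k) (hx : 0 ≤ x) :
    ∫⁻ y in Ioc 0 x, ENNReal.ofReal (Real.exp (-(k * (x - y)))) ≤ ENNReal.ofReal (1 / k) := by
  rw [← ofReal_integral_eq_lintegral_ofReal, ← intervalIntegral.integral_of_le hx]
  · refine ENNReal.ofReal_le_ofReal ?_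
    have hd : ∀ y : ℝ, HasDerivAt (fun y => Real.exp (-(k * (x - y))) / k)
        (Real.exp (-(k * (x - y)))) y := fun y => by
      have h1 : HasDerivAt (fun y => -(k * (x - y))) k y := by
        simpa using HasDerivAt.fun_neg (((hasDerivAt_id' y).const_sub x).const_mul k)
      refine (h1.exp.div_const k).congr_deriv ?_
      field_simp
    rw [intervalIntegral.integral_eq_sub_of_hasDerivAt (fun y _ => hd y)
      (Continuous.intervalIntegrable (by fun_prop) _ _)]
    have : 0 ≤ Real.exp (-(k * (x - 0))) / k := by positivity
    simp only [sub_self, mul_zero, neg_zero, Real.exp_zero]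
    linarith
  · exact (Continuous.integrableOn_Icc (by fun_prop)).mono_set Ioc_subset_Icc_self
  · exact ae_of_all _ fun y => (Real.exp_pos _).le

theorem ae_restrict_swap {s t : Set ℝ} {Q : ℝ × ℝ → Prop}
    (h : ∀ᵐ z ∂(volume.restrict (s ×ˢ t)), Q z) :
    ∀ᵐ x ∂(volume.restrict t), ∀ᵐ y ∂(volume.restrict s), Q (y, x) := by
  rw [Measure.volume_eq_prod, ← Measure.prod_restrict] at h
  exact Measure.ae_ae_of_ae_prod
    ((Measure.measurePreserving_swap (μ := volume.restrict t)
      (ν := volume.restrict s)).quasiMeasurePreserving.ae h)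

/-- A transport estimate in which `x` plays the role of the time: a quantity that is carried to
the right with unit speed from zero initial data, and that grows by `F` along the
characteristics, is controlled on the line `{x}`, in `L¹` in time with an exponential weight, by
its value on the line `{0}`. The weight makes the contribution of `F` small for large `k`. -/
theorem transport_estimate {T k : ℝ} (hk : 0 < k) {u F : ℝ → ℝ → ℝ≥0∞}
    (hF : Measurable (Function.uncurry F)) {C : ℝ≥0∞}
    (hC : ∀ᵐ x ∂(volume.restrict (Ioo (0 : ℝ) 1)),
      ∫⁻ t in Ioo 0 T, ENNReal.ofReal (Real.exp (-(k * t))) * F t x ≤ C)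
    (h0 : ∀ᵐ x ∂(volume.restrict (Ioo (0 : ℝ) 1)), u 0 x = 0)
    (hu : ∀ᵐ z : ℝ × ℝ ∂(volume.restrict (Ioo (0 : ℝ) T ×ˢ Ioo (0 : ℝ) 1)),
      u z.1 z.2 ≤ u (max 0 (z.1 - z.2)) (z.2 - z.1 + max 0 (z.1 - z.2)) +
        ∫⁻ s in Ioc (max 0 (z.1 - z.2)) z.1, F s (z.2 - z.1 + s)) :
    ∀ᵐ x ∂(volume.restrict (Ioo (0 : ℝ) 1)),
      ∫⁻ t in Ioo 0 T, ENNReal.ofReal (Real.exp (-(k * t))) * u t x ≤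
        ENNReal.ofReal (Real.exp (-(k * x))) *
          (∫⁻ t in Ioo 0 T, ENNReal.ofReal (Real.exp (-(k * t))) * u t 0) +
        ENNReal.ofReal (1 / k) * C := by
  set w : ℝ → ℝ≥0∞ := fun t => ENNReal.ofReal (Real.exp (-(k * t))) with hw
  have hwm : Measurable w := by fun_prop
  have hwadd : ∀ s t, w (s + t) = w t * w s := fun s t => by
    simp only [hw]
    rw [← ENNReal.ofReal_mul (Real.exp_nonneg _), ← Real.exp_add]
    congr 2
    ring
  set F₀ : ℝ → ℝ → ℝ≥0∞ := fun s y => (Ioo 0 T).indicator (fun s => F s y) s with hF₀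
  have hF₀m : Measurable (Function.uncurry F₀) :=
    hF.indicator (s := {z : ℝ × ℝ | z.1 ∈ Ioo 0 T}) (measurable_fst measurableSet_Ioo)
  filter_upwards [ae_restrict_swap hu, ae_restrict_mem measurableSet_Ioo] with x hx hxm
  -- The contribution of the values on the line `{0}`.
  set A : ℝ → ℝ≥0∞ := (Ioo x T).indicator fun t => w t * u (t - x) 0 with hA
  -- The contribution of `F`, with the position as the variable on the characteristic.
  set K : ℝ → ℝ → ℝ≥0∞ := fun t y => w t * (Ioc 0 x).indicator (fun y => F₀ (t - x + y) y) y with hK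
  have hKm : Measurable (Function.uncurry K) := by
    refine (hwm.comp measurable_fst).mul ?_
    refine Measurable.indicator (s := {z : ℝ × ℝ | z.2 ∈ Ioc 0 x})
      (f := fun z : ℝ × ℝ => F₀ (z.1 - x + z.2) z.2) ?_ (measurable_snd measurableSet_Ioc)
    exact hF₀m.comp (Measurable.prodMk (by fun_prop) measurable_snd)
  have hpt : ∀ᵐ t ∂(volume.restrict (Ioo 0 T)), w t * u t x ≤ A t + ∫⁻ y, K t y := by
    have h0' := (measurePreserving_const_sub x).quasiMeasurePreserving.ae
      ((ae_restrict_iff' measurableSet_Ioo).1 h0)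
    have hne : ∀ᵐ t : ℝ, t ≠ x := by simp [ae_iff]
    filter_upwards [hx, ae_restrict_of_ae h0', ae_restrict_of_ae hne,
      ae_restrict_mem measurableSet_Ioo] with t ht ht0 htx htm
    refine (mul_le_mul_right ht (w t)).trans ?_
    rw [mul_add]
    refine add_le_add ?_ ?_
    · rcases lt_or_gt_of_ne htx with h | h
      · rw [max_eq_left (by linarith), add_zero, ht0 ⟨by linarith, by linarith [hxm.2, htm.1]⟩,
          mul_zero]
        exact bot_le
      · rw [max_eq_right (by linarith), hA, indicator_of_mem (show t ∈ Ioo x T from ⟨h, htm.2⟩)]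
        refine mul_le_mul_right (le_of_eq ?_) _
        congr 1
        ring
    · simp only [hK]
      rw [lintegral_const_mul' _ _ ENNReal.ofReal_ne_top]
      refine mul_le_mul_right ?_ _
      rw [← lintegral_indicator measurableSet_Ioc, ← lintegral_add_right_eq_self _ (t - x)]
      refine lintegral_mono fun y => ?_
      by_cases hy : y + (t - x) ∈ Ioc (max 0 (t - x)) t
      · have h1 : 0 < y := by linarith [hy.1, le_max_right 0 (t - x)]
        have h2 : y ≤ x := by linarith [hy.2]
        have h3 : t - x + y ∈ Ioo 0 T :=
          ⟨by linarith [hy.1, le_max_left 0 (t - x)], by linarith [hy.2, htm.2]⟩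
        rw [indicator_of_mem hy, indicator_of_mem (show y ∈ Ioc 0 x from ⟨h1, h2⟩), hF₀]
        simp only
        rw [indicator_of_mem h3]
        refine le_of_eq ?_
        congr 1 <;> ring
      · rw [indicator_of_notMem hy]
        exact bot_le
  have hAle : ∫⁻ t in Ioo 0 T, A t ≤ w x * ∫⁻ t in Ioo 0 T, w t * u t 0 := by
    calc ∫⁻ t in Ioo 0 T, A t ≤ ∫⁻ t, A t := setLIntegral_le_lintegral _ _
      _ = ∫⁻ t, A (t + x) := (lintegral_add_right_eq_self _ x).symm
      _ ≤ ∫⁻ t, (Ioo 0 T).indicator (fun t => w x * (w t * u t 0)) t := by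
          refine lintegral_mono fun t => ?_
          by_cases ht : t + x ∈ Ioo x T
          · rw [hA, indicator_of_mem ht, indicator_of_mem (show t ∈ Ioo 0 T from
              ⟨by linarith [ht.1], by linarith [ht.2, hxm.1]⟩), hwadd, add_sub_cancel_right,
              mul_assoc]
          · rw [hA, indicator_of_notMem ht]
            exact bot_le
      _ = _ := by
          rw [lintegral_indicator measurableSet_Ioo, lintegral_const_mul' _ _ ENNReal.ofReal_ne_top]
  have hKle : ∫⁻ t in Ioo 0 T, ∫⁻ y, K t y ≤ ENNReal.ofReal (1 / k) * C := by
    have hy : ∀ᵐ y, ∫⁻ t, K t y ≤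
        (Ioc 0 x).indicator (fun y => ENNReal.ofReal (Real.exp (-(k * (x - y)))) * C) y := by
      filter_upwards [(ae_restrict_iff' measurableSet_Ioo).1 hC] with y hy
      by_cases hym : y ∈ Ioc 0 x
      · simp only [hK, indicator_of_mem hym]
        rw [← lintegral_add_right_eq_self _ (x - y)]
        have e : ∀ t, t + (x - y) - x + y = t := fun t => by ring
        simp_rw [e, hwadd, mul_assoc]
        rw [lintegral_const_mul' _ _ ENNReal.ofReal_ne_top]
        refine mul_le_mul_right (le_trans (le_of_eq ?_) (hy ⟨hym.1, by linarith [hym.2, hxm.2]⟩)) _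
        rw [← lintegral_indicator measurableSet_Ioo]
        refine lintegral_congr fun t => ?_
        simp only [hF₀, indicator_apply]
        split_ifs <;> simp_all
      · simp [hK, indicator_of_notMem hym]
    calc ∫⁻ t in Ioo 0 T, ∫⁻ y, K t y ≤ ∫⁻ t, ∫⁻ y, K t y := setLIntegral_le_lintegral _ _
      _ = ∫⁻ y, ∫⁻ t, K t y := lintegral_lintegral_swap hKm.aemeasurable
      _ ≤ ∫⁻ y in Ioc 0 x, ENNReal.ofReal (Real.exp (-(k * (x - y)))) * C := by
          rw [← lintegral_indicator measurableSet_Ioc]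
          exact lintegral_mono_ae hy
      _ ≤ _ := by
          rw [lintegral_mul_const _ (by fun_prop)]
          exact mul_le_mul_left (lintegral_exp_neg_le hk hxm.1.le) C
  calc ∫⁻ t in Ioo 0 T, w t * u t x ≤ ∫⁻ t in Ioo 0 T, (A t + ∫⁻ y, K t y) := lintegral_mono_ae hpt
    _ = (∫⁻ t in Ioo 0 T, A t) + ∫⁻ t in Ioo 0 T, ∫⁻ y, K t y :=
        lintegral_add_right _ hKm.lintegral_prod_right'
    _ ≤ _ := add_le_add hAle hKle

variable {p : ℝ≥0∞} {T : ℝ} {M : ℝ≥0} {a : ℝ → ℝ → ℝ}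

/-- The bound that the integral equation along a characteristic gives for its end value `r` in
terms of its starting value `r₀`. -/
theorem enorm_le_of_integral_eq {r r₀ : ℝ} {g φ : ℝ → ℝ} {s₀ t : ℝ} (hst : s₀ ≤ t)
    (h : r = r₀ + ∫ s in s₀..t, g s) (hg : ∀ᵐ s, s ∈ Ioc s₀ t → ‖g s‖ = 1 / 2 * ‖φ s‖) :
    ‖r‖ₑ ≤ ‖r₀‖ₑ + ∫⁻ s in Ioc s₀ t, ‖φ s‖ₑ := by
  rw [h, intervalIntegral.integral_of_le hst]
  refine (enorm_add_le _ _).trans (add_le_add le_rfl ?_)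
  refine (enorm_integral_le_lintegral_enorm _).trans (lintegral_mono_ae ?_)
  filter_upwards [(ae_restrict_iff' measurableSet_Ioc).2 hg] with s hs
  rw [enorm_le_iff_norm_le, hs]
  linarith [norm_nonneg (φ s)]

theorem InBroadSpace.ae_eq_zero (hp : 1 ≤ p) (hT : 0 < T) {u : ℝ → ℝ → ℝ}
    (hu : InBroadSpace p T u) {w : ℝ → ℝ≥0∞} (hwm : Measurable w) (hw : ∀ t, w t ≠ 0)
    (h : ∀ x ∈ Icc (0 : ℝ) 1, ∫⁻ t in Ioo 0 T, w t * ‖u t x‖ₑ = 0) :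
    ∀ t ∈ Icc (0 : ℝ) T, ∀ᵐ x ∂(volume.restrict (Ioo (0 : ℝ) 1)), u t x = 0 := by
  have hx : ∀ x ∈ Icc (0 : ℝ) 1, ∀ᵐ t ∂(volume.restrict (Ioo 0 T)), ‖u t x‖ₑ = 0 := by
    intro x hx
    have := (lintegral_eq_zero_iff' (hwm.aemeasurable.mul (hu.3.1 x hx).1.enorm)).1 (h x hx)
    filter_upwards [this] with t ht
    exact (mul_eq_zero.1 ht).resolve_left (hw t)
  have hm : AEMeasurable (fun z : ℝ × ℝ => ‖u z.1 z.2‖ₑ)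
      ((volume.restrict (Ioo (0 : ℝ) T)).prod (volume.restrict (Ioo (0 : ℝ) 1))) := by
    rw [Measure.prod_restrict]
    exact hu.1.enorm
  have h0 : ∫⁻ t in Ioo 0 T, ∫⁻ x in Ioo (0 : ℝ) 1, ‖u t x‖ₑ = 0 := by
    rw [lintegral_lintegral_swap hm]
    refine lintegral_eq_zero_of_ae_eq_zero ?_
    filter_upwards [ae_restrict_mem measurableSet_Ioo] with x hxm
    exact lintegral_eq_zero_of_ae_eq_zero (hx x (Ioo_subset_Icc_self hxm))
  obtain ⟨hc, -⟩ := hu.2.continuousOn_lintegral hp (w := fun _ => 1) (ae_of_all _ fun _ => le_rfl)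
  simp only [one_mul] at hc
  have h1 := le_of_ae_le_of_continuousOn hT hc (continuousOn_const (c := 0)) (by
    filter_upwards [(lintegral_eq_zero_iff' hm.lintegral_prod_right').1 h0] with t ht
    exact ht.le)
  intro t ht
  filter_upwards [(lintegral_eq_zero_iff' (hu.2.1 t ht).1.enorm).1 (le_bot_iff.1 (h1 t ht))]
    with x hx
  exact enorm_eq_zero.1 hx

/-- A broad solution with zero initial value vanishes. In the exponentially weighted `L¹` norms
on the lines `{x}`, each component at the end where it leaves the domain is at most a small multiple
of itself at the end where it enters, because it takes a unit of time to cross the domain, up to a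
small multiple of the interior norms. The boundary conditions identify the two components at each
end, so that all these norms vanish. -/
theorem IsBroadSolutionOn.eq_zero (hp : 1 ≤ p) (hT : 0 < T) (ha : IsBoundedDamping M T a)
    {ρ ξ : ℝ → ℝ → ℝ} (h : IsBroadSolutionOn p a 0 0 T ρ ξ) :
    ∀ t ∈ Icc (0 : ℝ) T, (∀ᵐ x ∂(volume.restrict (Ioo (0 : ℝ) 1)), ρ t x = 0) ∧
      ∀ᵐ x ∂(volume.restrict (Ioo (0 : ℝ) 1)), ξ t x = 0 := by
  have hD : MeasurableSet (Ioo (0 : ℝ) T ×ˢ Ioo (0 : ℝ) 1) :=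
    measurableSet_Ioo.prod measurableSet_Ioo
  -- With this rate, `exp (-k) ≤ 1 / 4` and `M / k ≤ 1 / 8`.
  set k : ℝ := 8 * (M + 1) with hk
  have hk0 : 0 < k := by positivity
  set w : ℝ → ℝ≥0∞ := fun t => ENNReal.ofReal (Real.exp (-(k * t))) with hw
  have hwc : Continuous w := ENNReal.continuous_ofReal.comp (by fun_prop)
  have hwm : Measurable w := hwc.measurable
  have hw1 : ∀ᵐ t ∂(volume.restrict (Ioo 0 T)), w t ≤ 1 := by
    filter_upwards [ae_restrict_mem measurableSet_Ioo] with t ht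
    rw [hw, ← ENNReal.ofReal_one]
    refine ENNReal.ofReal_le_ofReal (Real.exp_le_one_iff.2 ?_)
    have := mul_pos hk0 ht.1
    linarith
  obtain ⟨hcρ, hfρ⟩ := h.1.3.continuousOn_lintegral hp hw1
  obtain ⟨hcξ, hfξ⟩ := h.2.3.continuousOn_lintegral hp hw1
  set Bρ : ℝ → ℝ≥0∞ := fun x => ∫⁻ t in Ioo 0 T, w t * ‖ρ t x‖ₑ with hBρ
  set Bξ : ℝ → ℝ≥0∞ := fun x => ∫⁻ t in Ioo 0 T, w t * ‖ξ t x‖ₑ with hBξ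
  obtain ⟨xm, hxm, hmax⟩ := isCompact_Icc.exists_isMaxOn ⟨0, left_mem_Icc.2 zero_le_one⟩
    (hcρ.add hcξ)
  set S : ℝ≥0∞ := Bρ xm + Bξ xm with hS
  have hSle : ∀ x ∈ Icc (0 : ℝ) 1, Bρ x + Bξ x ≤ S := fun x hx => hmax hx
  have hSfin : S ≠ ∞ := ENNReal.add_ne_top.2 ⟨hfρ xm hxm, hfξ xm hxm⟩
  -- A measurable version of the right-hand side.
  have hφ := (ha.integrable_mul (v := fun t x => ρ t x - ξ t x)
    ((h.1.sub hp h.2).integrable hp hT)).1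
  set φ : ℝ × ℝ → ℝ := hφ.mk _ with hφdef
  have hφm : Measurable φ := hφ.stronglyMeasurable_mk.measurable
  have hφe : ∀ᵐ z ∂(volume.restrict (Ioo (0 : ℝ) T ×ˢ Ioo (0 : ℝ) 1)),
      a z.1 z.2 * (ρ z.1 z.2 - ξ z.1 z.2) = φ z := hφ.ae_eq_mk
  have hφe' := (ae_restrict_iff' hD).1 hφe
  set F : ℝ → ℝ → ℝ≥0∞ := fun t x => ‖φ (t, x)‖ₑ with hF
  have hFm : Measurable (Function.uncurry F) := hφm.enorm
  have hC : ∀ᵐ x ∂(volume.restrict (Ioo (0 : ℝ) 1)), ∫⁻ t in Ioo 0 T, w t * F t x ≤ M * S := by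
    filter_upwards [ae_restrict_swap hφe, ae_restrict_swap ha.2, ae_restrict_mem measurableSet_Ioo]
      with x h1 h2 hxI
    have hxI' := Ioo_subset_Icc_self hxI
    calc ∫⁻ t in Ioo 0 T, w t * F t x
        ≤ ∫⁻ t in Ioo 0 T, M * (w t * ‖ρ t x‖ₑ + w t * ‖ξ t x‖ₑ) := by
          refine lintegral_mono_ae ?_
          filter_upwards [h1, h2] with t e1 e2
          calc w t * F t x = w t * (‖a t x‖ₑ * ‖ρ t x - ξ t x‖ₑ) := by
                rw [← enorm_mul, e1]
            _ ≤ w t * (M * (‖ρ t x‖ₑ + ‖ξ t x‖ₑ)) := by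
                gcongr
                exact enorm_sub_le
            _ = _ := by ring
      _ = M * (Bρ x + Bξ x) := by
          rw [lintegral_const_mul' _ _ ENNReal.coe_ne_top,
            lintegral_add_left' (f := fun t => w t * ‖ρ t x‖ₑ)
            (hwm.aemeasurable.mul (h.1.3.1 x hxI').1.enorm)]
      _ ≤ M * S := by
          gcongr
          exact hSle x hxI'
  have hrefl : MeasurePreserving (fun z : ℝ × ℝ => (z.1, 1 - z.2)) volume volume := by
    rw [Measure.volume_eq_prod]
    exact (MeasurePreserving.id volume).prod (measurePreserving_const_sub 1)
  have hξle : ∀ x ∈ Icc (0 : ℝ) 1, Bξ x ≤ w x * Bξ 0 + ENNReal.ofReal (1 / k) * (M * S) := by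
    refine le_of_ae_le_of_continuousOn one_pos hcξ ?_ (transport_estimate hk0
      (u := fun t x => ‖ξ t x‖ₑ) hFm hC ?_ ?_)
    · have h1 := hfξ 0 (left_mem_Icc.2 zero_le_one)
      exact (((ENNReal.continuous_mul_const h1).comp hwc).add
        continuous_const).continuousOn
    · filter_upwards [h.8] with x hx
      simp [hx]
    · filter_upwards [h.4, ae_restrict_of_ae (ae_char (σ := 1) (Or.inl rfl) hφe'),
        ae_restrict_mem hD] with z e hz hzD
      obtain ⟨⟨ht0, htT⟩, ⟨hx0, hx1⟩⟩ := hzD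
      set s₀ := max 0 (z.1 - z.2) with hs₀
      have h0 : 0 ≤ s₀ := le_max_left _ _
      have h1 : z.1 - z.2 ≤ s₀ := le_max_right _ _
      refine enorm_le_of_integral_eq (max_le ht0.le (by linarith)) e ?_
      filter_upwards [hz] with s hs hsm
      have ec : z.2 - 1 * (z.1 - s) = z.2 - z.1 + s := by ring
      rw [ec] at hs
      rw [← hs ⟨⟨h0.trans_lt hsm.1, hsm.2.trans_lt htT⟩, ⟨by simp only; linarith [hsm.1],
        by simp only; linarith [hsm.2]⟩⟩, mul_assoc, norm_mul]
      norm_num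
  have hρle : ∀ x ∈ Icc (0 : ℝ) 1,
      Bρ (1 - x) ≤ w x * Bρ 1 + ENNReal.ofReal (1 / k) * (M * S) := by
    have hmaps : MapsTo (fun x : ℝ => 1 - x) (Icc 0 1) (Icc 0 1) := fun x hx =>
      ⟨by linarith [hx.2], by linarith [hx.1]⟩
    have hae1 : ∀ {Q : ℝ → Prop}, (∀ᵐ x ∂(volume.restrict (Ioo (0 : ℝ) 1)), Q x) →
        ∀ᵐ x ∂(volume.restrict (Ioo (0 : ℝ) 1)), Q (1 - x) := fun {Q} hQ => by
      rw [ae_restrict_iff' measurableSet_Ioo] at hQ ⊢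
      filter_upwards [(measurePreserving_const_sub 1).quasiMeasurePreserving.ae hQ] with x hx hxm
      exact hx ⟨by linarith [hxm.2], by linarith [hxm.1]⟩
    have hest := transport_estimate (T := T) hk0 (u := fun t x => ‖ρ t (1 - x)‖ₑ)
      (F := fun t x => F t (1 - x)) (C := M * S)
      (hFm.comp (f := fun z : ℝ × ℝ => (z.1, 1 - z.2)) (by fun_prop)) (hae1 hC) ?_ ?_
    · simp only [sub_zero] at hest
      refine le_of_ae_le_of_continuousOn one_pos (hcρ.comp (by fun_prop) hmaps) ?_ hest
      have h1 := hfρ 1 (right_mem_Icc.2 zero_le_one)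
      exact (((ENNReal.continuous_mul_const h1).comp hwc).add
        continuous_const).continuousOn
    · filter_upwards [hae1 h.7] with x hx
      simp [hx]
    · have h3 := hrefl.quasiMeasurePreserving.ae ((ae_restrict_iff' hD).1 h.3)
      have h4 := hrefl.quasiMeasurePreserving.ae (ae_char (σ := -1) (Or.inr rfl) hφe')
      filter_upwards [ae_restrict_of_ae h3, ae_restrict_of_ae h4, ae_restrict_mem hD]
        with z e hz hzD
      obtain ⟨⟨ht0, htT⟩, ⟨hx0, hx1⟩⟩ := hzD
      have e' := e ⟨⟨ht0, htT⟩, ⟨by simp only; linarith, by simp only; linarith⟩⟩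
      have em : z.1 + (1 - z.2) - 1 = z.1 - z.2 := by ring
      simp only [em] at e'
      set s₀ := max 0 (z.1 - z.2) with hs₀
      have h0 : 0 ≤ s₀ := le_max_left _ _
      have h1 : z.1 - z.2 ≤ s₀ := le_max_right _ _
      have ep : ∀ s, 1 - z.2 + z.1 - s = 1 - (z.2 - z.1 + s) := fun s => by ring
      simp only [ep] at e'
      refine enorm_le_of_integral_eq (max_le ht0.le (by linarith)) e' ?_
      filter_upwards [hz] with s hs hsm
      have ec : 1 - z.2 - -1 * (z.1 - s) = 1 - (z.2 - z.1 + s) := by ring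
      simp only [ec] at hs
      rw [← hs ⟨⟨h0.trans_lt hsm.1, hsm.2.trans_lt htT⟩, ⟨by simp only; linarith [hsm.2],
        by simp only; linarith [hsm.1]⟩⟩, mul_assoc, norm_mul]
      norm_num
  -- The boundary conditions close the estimate.
  have hb0 : Bξ 0 = Bρ 0 := by
    refine lintegral_congr_ae ?_
    filter_upwards [h.5] with t ht
    rw [sub_eq_zero.1 ht]
  have hb1 : Bξ 1 = Bρ 1 := by
    refine lintegral_congr_ae ?_
    filter_upwards [h.6] with t ht
    rw [sub_eq_zero.1 ht]
  have hS0 : S = 0 := by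
    have hw14 : w 1 ≤ ENNReal.ofReal (1 / 4) := by
      refine ENNReal.ofReal_le_ofReal ?_
      rw [mul_one, Real.exp_neg, ← one_div]
      refine one_div_le_one_div_of_le (by norm_num) ?_
      have h1 := Real.add_one_le_exp k
      have h2 : (0 : ℝ) ≤ M := M.2
      linarith
    have hδ : ENNReal.ofReal (1 / k) * (M * S) ≤ ENNReal.ofReal (1 / 8) * S := by
      rw [← mul_assoc, ← ENNReal.ofReal_coe_nnreal, ← ENNReal.ofReal_mul (by positivity)]
      gcongr
      rw [hk]
      have h2 : (0 : ℝ) ≤ M := M.2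
      rw [div_mul_eq_mul_div, one_mul, div_le_div_iff₀ (by positivity) (by norm_num)]
      linarith
    have hw1' : ∀ x ∈ Icc (0 : ℝ) 1, w x ≤ 1 := fun x hx => by
      rw [hw, ← ENNReal.ofReal_one]
      refine ENNReal.ofReal_le_ofReal (Real.exp_le_one_iff.2 ?_)
      have := mul_nonneg hk0.le hx.1
      linarith
    have h1m : (1 : ℝ) ∈ Icc (0 : ℝ) 1 := right_mem_Icc.2 zero_le_one
    have h0m : (0 : ℝ) ∈ Icc (0 : ℝ) 1 := left_mem_Icc.2 zero_le_one
    have hxm' : 1 - xm ∈ Icc (0 : ℝ) 1 := ⟨by linarith [hxm.2], by linarith [hxm.1]⟩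
    have i1 : Bρ 1 ≤ ENNReal.ofReal (1 / 4) * Bρ 0 + ENNReal.ofReal (1 / 8) * S := by
      have := hξle 1 h1m
      rw [hb1, hb0] at this
      exact this.trans (add_le_add (mul_le_mul_left hw14 _) hδ)
    have i2 : Bρ 0 ≤ ENNReal.ofReal (1 / 4) * Bρ 1 + ENNReal.ofReal (1 / 8) * S := by
      have := hρle 1 h1m
      rw [sub_self] at this
      exact this.trans (add_le_add (mul_le_mul_left hw14 _) hδ)
    have i3 : S ≤ (Bρ 1 + ENNReal.ofReal (1 / 8) * S) + (Bρ 0 + ENNReal.ofReal (1 / 8) * S) := by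
      refine add_le_add ?_ ?_
      · have := hρle _ hxm'
        rw [sub_sub_cancel] at this
        exact this.trans (add_le_add (mul_le_of_le_one_left bot_le (hw1' _ hxm')) hδ)
      · have := hξle _ hxm
        rw [hb0] at this
        exact this.trans (add_le_add (mul_le_of_le_one_left bot_le (hw1' _ hxm)) hδ)
    have hX := hfρ 0 h0m
    have hY := hfρ 1 h1m
    change Bρ 0 ≠ ∞ at hX
    change Bρ 1 ≠ ∞ at hY
    clear_value S
    generalize Bρ 0 = X at *
    generalize Bρ 1 = Y at *
    lift X to ℝ≥0 using hX
    lift Y to ℝ≥0 using hY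
    lift S to ℝ≥0 using hSfin
    simp only [ENNReal.ofReal] at i1 i2 i3
    norm_cast at i1 i2 i3 ⊢
    rw [← NNReal.coe_le_coe] at i1 i2 i3
    push_cast [Real.coe_toNNReal (1 / 4) (by norm_num), Real.coe_toNNReal (1 / 8) (by norm_num)]
      at i1 i2 i3
    rw [← NNReal.coe_eq_zero]
    linarith [S.2]
  have hwne : ∀ t, w t ≠ 0 := fun t => by simp [hw, Real.exp_pos]
  have hzero : ∀ x ∈ Icc (0 : ℝ) 1, Bρ x = 0 ∧ Bξ x = 0 := fun x hx => by
    have := hSle x hx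
    rw [hS0, nonpos_iff_eq_zero, add_eq_zero] at this
    exact this
  intro t ht
  exact ⟨h.1.ae_eq_zero hp hT hwm hwne (fun x hx => (hzero x hx).1) t ht,
    h.2.ae_eq_zero hp hT hwm hwne (fun x hx => (hzero x hx).2) t ht⟩

end

/-! ### Reduction of the coefficient, and the decay rate -/

/-- A damping coefficient with the required bounds almost everywhere agrees almost everywhere with
one that satisfies them everywhere. -/
theorem exists_damping {M m : ℝ≥0} {l : ℝ} (hl : 0 < l) (hM : M ≤ 2 * m) (hlm : l ≤ 2 * m)
    {a : ℝ → ℝ → ℝ} {x₀ ε : ℝ}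
    (ha : AEStronglyMeasurable (fun z : ℝ × ℝ => a z.1 z.2)
      (volume.restrict (Ioi (0 : ℝ) ×ˢ Ioo (0 : ℝ) 1)))
    (haM : ∀ᵐ z : ℝ × ℝ ∂(volume.restrict (Ioi (0 : ℝ) ×ˢ Ioo (0 : ℝ) 1)), ‖a z.1 z.2‖ₑ ≤ M)
    (ha0 : ∀ᵐ z : ℝ × ℝ ∂(volume.restrict (Ioi (0 : ℝ) ×ˢ Ioo (0 : ℝ) 1)), 0 ≤ a z.1 z.2)
    (hal : ∀ᵐ z : ℝ × ℝ ∂(volume.restrict (Ioi (0 : ℝ) ×ˢ Ioo (x₀ - ε) (x₀ + ε))),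
      l ≤ a z.1 z.2) :
    ∃ b : ℝ → ℝ → ℝ, Damping m b ∧ (∀ t, 0 < t → ∀ x ∈ Ioo (x₀ - ε) (x₀ + ε), l ≤ b t x) ∧
      ∀ᵐ z : ℝ × ℝ ∂(volume.restrict (Ioi (0 : ℝ) ×ˢ Ioo (0 : ℝ) 1)), a z.1 z.2 = b z.1 z.2 := by
  have hSm : MeasurableSet (Ioi (0 : ℝ) ×ˢ Ioo (x₀ - ε) (x₀ + ε)) :=
    measurableSet_Ioi.prod measurableSet_Ioo
  set S : Set (ℝ × ℝ) := Ioi (0 : ℝ) ×ˢ Ioo (x₀ - ε) (x₀ + ε) with hS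
  set a' : ℝ × ℝ → ℝ := ha.mk _ with ha'
  have ham : Measurable a' := ha.stronglyMeasurable_mk.measurable
  have hae : ∀ᵐ z : ℝ × ℝ ∂(volume.restrict (Ioi (0 : ℝ) ×ˢ Ioo (0 : ℝ) 1)),
      a z.1 z.2 = a' z := ha.ae_eq_mk
  have hm0 : (0 : ℝ) ≤ 2 * m := by positivity
  have hind : ∀ z, S.indicator (fun _ => l) z ≤ 2 * m := fun z =>
    (indicator_le_self' (fun _ _ => hl.le) z).trans hlm
  refine ⟨fun t x => max (max 0 (min (a' (t, x)) (2 * m))) (S.indicator (fun _ => l) (t, x)),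
    ⟨?_, fun t x => ?_, fun t x => ?_⟩, fun t ht x hx => ?_, ?_⟩
  · exact (measurable_const.max (ham.min measurable_const)).max (measurable_const.indicator hSm)
  · exact (le_max_left _ _).trans (le_max_left _ _)
  · exact max_le (max_le hm0 (min_le_right _ _)) (hind _)
  · exact (indicator_of_mem (show (t, x) ∈ S from ⟨ht, hx⟩) fun _ => l).ge.trans (le_max_right _ _)
  · filter_upwards [hae, haM, ha0, ae_restrict_of_ae ((ae_restrict_iff' hSm).1 hal)]
      with z h1 h2 h3 h4
    have h5 : a z.1 z.2 ≤ M := by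
      have : ‖a z.1 z.2‖ ≤ M := by
        rw [← coe_nnnorm]
        exact_mod_cast h2
      exact (le_abs_self _).trans this
    have h6 : (M : ℝ) ≤ 2 * m := by exact_mod_cast hM
    simp only [Prod.mk.eta]
    rw [← h1, min_eq_left (h5.trans h6), max_eq_right h3, max_eq_left]
    by_cases hz : z ∈ S
    · rw [indicator_of_mem hz]
      exact h4 hz
    · rwa [indicator_of_notMem hz]

theorem pairLpNorm_congr {p : ℝ≥0∞} {f g f' g' : ℝ → ℝ}
    (hf : ∀ᵐ x ∂(volume.restrict (Ioo (0 : ℝ) 1)), f x = f' x)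
    (hg : ∀ᵐ x ∂(volume.restrict (Ioo (0 : ℝ) 1)), g x = g' x) :
    pairLpNorm p f g = pairLpNorm p f' g' := by
  unfold pairLpNorm
  congr 1
  refine lintegral_congr_ae ?_
  filter_upwards [hf, hg] with x h1 h2
  rw [h1, h2]

theorem IsBroadSolution.ae_eq {p : ℝ≥0∞} (hp : 1 ≤ p) {M : ℝ≥0} {a : ℝ → ℝ → ℝ}
    (ha : ∀ T, IsBoundedDamping M T a) {ρ₀ ξ₀ : ℝ → ℝ} {ρ ξ ρ' ξ' : ℝ → ℝ → ℝ}
    (h : IsBroadSolution p a ρ₀ ξ₀ ρ ξ) (h' : IsBroadSolution p a ρ₀ ξ₀ ρ' ξ') {t : ℝ}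
    (ht : 0 ≤ t) :
    ρ t =ᵐ[volume.restrict (Ioo (0 : ℝ) 1)] ρ' t ∧
      ξ t =ᵐ[volume.restrict (Ioo (0 : ℝ) 1)] ξ' t := by
  have hT : 0 < t + 1 := by linarith
  obtain ⟨h1, h2⟩ := ((h _ hT).sub hp hT (ha _) (h' _ hT)).eq_zero hp hT (ha _) t
    ⟨ht, by linarith⟩
  exact ⟨h1.mono fun x hx => sub_eq_zero.1 hx, h2.mono fun x hx => sub_eq_zero.1 hx⟩

/-- Geometric decay over time steps of length `τ` is exponential decay. -/
theorem pow_floor_le {θ τ t : ℝ} (hθ : 0 < θ) (hθ1 : θ ≤ 1) (hτ : 0 < τ) :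
    θ ^ ⌊t / τ⌋₊ ≤ 1 / θ * Real.exp (-(-Real.log θ / τ) * t) := by
  have h1 : Real.exp (-(-Real.log θ / τ) * t) = θ ^ (t / τ) := by
    rw [Real.rpow_def_of_pos hθ]
    congr 1
    field_simp
  rw [h1, one_div, ← Real.rpow_neg_one, ← Real.rpow_add hθ, ← Real.rpow_natCast]
  refine Real.rpow_le_rpow_of_exponent_ge hθ hθ1 ?_
  linarith [Nat.lt_floor_add_one (t / τ)]

end DampedWave

theorem theorem2 (p : ℝ≥0∞) (hp : 1 < p) (hp' : p < ∞) (ε₀ : ℝ) (hε₀ : 0 < ε₀)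
    (l : ℝ) (hl : 0 < l) (M : ℝ≥0) :
    ∃ C : ℝ, 0 < C ∧ ∃ γ : ℝ, 0 < γ ∧
      ∀ (a : ℝ → ℝ → ℝ) (x₀ : ℝ),
        MemLp (fun z : ℝ × ℝ => a z.1 z.2) ∞
          (volume.restrict (Ioi (0 : ℝ) ×ˢ Ioo (0 : ℝ) 1)) →
        eLpNorm (fun z : ℝ × ℝ => a z.1 z.2) ∞
          (volume.restrict (Ioi (0 : ℝ) ×ˢ Ioo (0 : ℝ) 1)) ≤ (M : ℝ≥0∞) →
        (∀ᵐ z : ℝ × ℝ ∂(volume.restrict (Ioi (0 : ℝ) ×ˢ Ioo (0 : ℝ) 1)), 0 ≤ a z.1 z.2) →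
        x₀ ∈ Ioo (0 : ℝ) 1 →
        Ioo (x₀ - ε₀) (x₀ + ε₀) ⊆ Ioo (0 : ℝ) 1 →
        (∀ᵐ z : ℝ × ℝ ∂(volume.restrict (Ioi (0 : ℝ) ×ˢ Ioo (x₀ - ε₀) (x₀ + ε₀))),
          l ≤ a z.1 z.2) →
        ∀ ρ₀ ξ₀ : ℝ → ℝ,
          MemLp ρ₀ p (volume.restrict (Ioo (0 : ℝ) 1)) →
          MemLp ξ₀ p (volume.restrict (Ioo (0 : ℝ) 1)) →
          (∃ ρ ξ : ℝ → ℝ → ℝ, DampedWave.IsBroadSolution p a ρ₀ ξ₀ ρ ξ) ∧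
          (∀ ρ ξ ρ' ξ' : ℝ → ℝ → ℝ,
            DampedWave.IsBroadSolution p a ρ₀ ξ₀ ρ ξ →
            DampedWave.IsBroadSolution p a ρ₀ ξ₀ ρ' ξ' →
            ∀ t : ℝ, 0 ≤ t →
              ρ t =ᵐ[volume.restrict (Ioo (0 : ℝ) 1)] ρ' t ∧
              ξ t =ᵐ[volume.restrict (Ioo (0 : ℝ) 1)] ξ' t) ∧
          (∀ ρ ξ : ℝ → ℝ → ℝ,
            DampedWave.IsBroadSolution p a ρ₀ ξ₀ ρ ξ →
            ∀ t : ℝ, 0 ≤ t →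
              DampedWave.pairLpNorm p
                  (fun x => ρ t x - DampedWave.meanValue ρ₀ ξ₀)
                  (fun x => ξ t x - DampedWave.meanValue ρ₀ ξ₀) ≤
                ENNReal.ofReal (C * Real.exp (-γ * t)) *
                  DampedWave.pairLpNorm p
                    (fun x => ρ₀ x - DampedWave.meanValue ρ₀ ξ₀)
                    (fun x => ξ₀ x - DampedWave.meanValue ρ₀ ξ₀)) := by
  -- The jump rate is half of an upper bound of the damping, and `l` may exceed `M`.
  set m : ℝ≥0 := max M l.toNNReal / 2 with hm
  have hm2 : 2 * m = max M l.toNNReal := mul_div_cancel₀ _ two_ne_zero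
  have hM : M ≤ 2 * m := hm2 ▸ le_max_left _ _
  have hlm : l ≤ 2 * m := by
    have h1 : l.toNNReal ≤ 2 * m := hm2 ▸ le_max_right _ _
    have h2 : (l.toNNReal : ℝ) ≤ 2 * m := by exact_mod_cast h1
    rwa [Real.coe_toNNReal l hl.le] at h2
  obtain ⟨κ, hκ0, hκ4, τ, hτ, hκ⟩ := DampedWave.exists_smul_volume_le_kernel m hl hε₀
  have hκ4' : (κ : ℝ) ≤ 1 / 4 := by exact_mod_cast hκ4
  have hκ0' : (0 : ℝ) < κ := hκ0
  set θ : ℝ := 1 - 2 * κ with hθ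
  have hθ0 : 0 < θ := by linarith
  have hθ1 : θ < 1 := by linarith
  have hθe : (1 - 2 * κ : ℝ≥0∞) = ENNReal.ofReal θ := by
    rw [hθ, ENNReal.ofReal_sub _ (by positivity), ENNReal.ofReal_mul two_pos.le]
    simp
  refine ⟨1 / θ, by positivity, -Real.log θ / τ, div_pos (neg_pos.2 (Real.log_neg hθ0 hθ1)) hτ, ?_⟩
  intro a x₀ ha haM ha0 _ hε hal ρ₀ ξ₀ hρ₀ hξ₀
  have haM' : ∀ᵐ z : ℝ × ℝ ∂(volume.restrict (Ioi (0 : ℝ) ×ˢ Ioo (0 : ℝ) 1)),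
      ‖a z.1 z.2‖ₑ ≤ M := by
    rw [eLpNorm_exponent_top] at haM
    filter_upwards [enorm_ae_le_eLpNormEssSup (fun z : ℝ × ℝ => a z.1 z.2) _] with z hz
    exact hz.trans haM
  obtain ⟨b, hb, hbl, hab⟩ := DampedWave.exists_damping hl hM hlm ha.1 haM' ha0 hal
  have haT : ∀ T, DampedWave.IsBoundedDamping M T a := fun T =>
    have hle : volume.restrict (Ioo (0 : ℝ) T ×ˢ Ioo (0 : ℝ) 1) ≤
        volume.restrict (Ioi (0 : ℝ) ×ˢ Ioo (0 : ℝ) 1) :=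
      Measure.restrict_mono (prod_mono Ioo_subset_Ioi_self subset_rfl) le_rfl
    ⟨ha.1.mono_measure hle, ae_mono hle haM'⟩
  set c := DampedWave.meanValue ρ₀ ξ₀ with hc
  obtain ⟨h, hh, hhp, hρ, hξ⟩ :=
    DampedWave.exists_loop_data (zero_lt_one.trans hp).ne' hp'.ne hρ₀ hξ₀ c
  have hii : ∀ {f : ℝ → ℝ}, MemLp f p (volume.restrict (Ioo (0 : ℝ) 1)) →
      IntervalIntegrable f volume 0 1 := fun {f} hf => by
    rw [intervalIntegrable_iff_integrableOn_Ioo_of_le zero_le_one]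
    exact hf.integrable hp.le
  have h0 := DampedWave.lintegral_pos_eq_lintegral_neg (hhp.integrable hp.le) (hii hρ₀) (hii hξ₀)
    hρ hξ
  have hsol := hb.isBroadSolutionOn_wave hp hp'.ne hh hhp c hab hρ hξ
  refine ⟨⟨_, _, hsol⟩, fun ρ ξ ρ' ξ' hs hs' t ht => hs.ae_eq hp.le haT hs' ht,
    fun ρ ξ hs t ht => ?_⟩
  obtain ⟨h1, h2⟩ := hs.ae_eq hp.le haT hsol ht
  have hn : (⌊t / τ⌋₊ : ℝ) * τ ≤ t :=
    (le_div_iff₀ hτ).1 (Nat.floor_le (div_nonneg ht hτ.le))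
  rw [DampedWave.pairLpNorm_congr (h1.mono fun x hx => congrArg (· - c) hx)
      (h2.mono fun x hx => congrArg (· - c) hx),
    DampedWave.pairLpNorm_congr (f := fun x => ρ₀ x - c) (g := fun x => ξ₀ x - c)
      (f' := fun x => h ((-x : ℝ) : DampedWave.Loop)) (g' := fun x => h (x : DampedWave.Loop))
      (hρ.mono fun x hx => by rw [← hx, add_sub_cancel_left])
      (hξ.mono fun x hx => by rw [← hx, add_sub_cancel_left])]
  refine (hb.pairLpNorm_wave_le hp hp'.ne hh hhp c h0 hτ.le (hκ b hb x₀ hε hbl) _ hn).trans ?_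
  rw [hθe, ← ENNReal.ofReal_pow hθ0.le]
  exact mul_le_mul_left (ENNReal.ofReal_le_ofReal (DampedWave.pow_floor_le hθ0 hθ1.le hτ)) _
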